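/- **Setting.** Let $\mathcal A$ be a finite action set, $\mathcal Y$ the outcome space (a standard Borel space, e.g. a Borel subset of a Euclidean space) and $R:\mathcal Y\to\mathbb R$ a measurable reward function. On a probability space there is a random outcome distribution $p^*$ on $\mathcal Y^{\mathcal A}$, taking values in a family $\mathcal P$; conditionally on $p^*$ the outcome vectors $Y_t=(Y_{t,a})_{a\in\mathcal A}$ are i.i.d. with law $p^*$. The optimal action $A^*\in\arg\max_{a}\mathbb E[R(Y_{t,a})\mid p^*]$ is a function of $p^*$. Let $\mathcal F_t$ be the $\sigma$-algebra generated by the history $(A_s,Y_{s,A_s})_{s<t}$; the action $A_t$ is a measurable function of the history and of a random seed $U_t$, where each $U_t$ is independent of $((U_s)_{s\ne t},(Y_{s,a})_{s,a},p^*)$. Write $\mathbb P_t=\mathbb P(\cdot\mid\mathcal F_t)$, $\mathbb E_t=\mathbb E[\cdot\mid\mathcal F_t]$, $P_t(X)=\mathbb P_t(X\in\cdot)$, $D$ for Kullback–Leibler divergence, and $I_t(X;Y)=D(P_t(X,Y)\,\|\,P_t(X)P_t(Y))$ for mutual information under $\mathbb P_t$. A real random variable $X$ is $\sigma$ sub-Gaussian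 conditionally on $\mathcal F_t$ if for every $\lambda\in\mathbb R$, $\mathbb E[e^{\lambda X}\mid\mathcal F_t]\le e^{\lambda^2\sigma^2/2}$ almost surely. Thompson sampling is the policy with $\mathbb P_t(A_t=a)=\mathbb P_t(A^*=a)$ for all $t$ and $a$. Put $$\Gamma_t=\frac{\big(\mathbb E_t[R(Y_{t,A^*})-R(Y_{t,A_t})]\big)^2}{I_t\big(A^*;(A_t,Y_{t,A_t})\big)}$$ with $0/0=0$ and $x/0=\infty$ for $x>0$. Fix a period $t$. **(1)** Let $\sigma\ge 0$ be an $\mathcal F_t$-measurable random variable such that for every $a\in\mathcal A$, $R(Y_{t,a})-\mathbb E_t[R(Y_{t,a})]$ is $\sigma$ sub-Gaussian conditionally on $\mathcal F_t$. Then for all $a,a^*\in\mathcal A$, almost surely on the event $\mathbb P_t(A^*=a^*)>0$, the expectations and the divergence below are finite and $$\mathbb E_t[R(Y_{t,a})\mid A^*=a^*]-\mathbb E_t[R(Y_{t,a})]\le\sigma\sqrt{2\,D\big(P_t(Y_{t,a}\mid A^*=a^*)\,\|\,P_t(Y_{t,a})\big)} .$$ **(2)** Let actions be chosen by Thompson sampling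 and let $\sigma\in\mathbb R$ be a constant such that for every $a$, $R(Y_{t,a})-\mathbb E_t[R(Y_{t,a})]$ is $\sigma$ sub-Gaussian conditionally on $\mathcal F_t$. Then, almost surely, the expectation and the mutual information in $\Gamma_t$ are finite and: * $\Gamma_t\le 2|\mathcal A|\sigma^2$; * (full information) if there is a random variable $Z_t$ with $Y_{t,a}=(a,Z_t)$ for every $a$, then $\Gamma_t\le 2\sigma^2$; * (linear bandit) if each action $a$ has a feature vector in $\mathbb R^d$, also written $a$, and for every $p\in\mathcal P$ there is $\theta_p\in\mathbb R^d$ with $\mathbb E_{y\sim p_a}[R(y)]=a^{T}\theta_p$ for all $a$, where $p_a$ is the $a$-th marginal of $p$, then $\Gamma_t\le 2d\sigma^2$. **(3)** (Semi-bandit.) Let actions be chosen by Thompson sampling, let $m\ge1$, let the actions be subsets of $\{1,\dots,d\}$ of size at most $m$, and let $\theta_{t,1},\dots,\theta_{t,d}$ be real random variables, independent conditionally on $\mathcal F_t$, with $Y_{t,a}=(\theta_{t,i}:i\in a)$ and $R(Y_{t,a})=\frac1m\sum_{i\in a}\theta_{t,i}$. If $\sigma\in\mathbb R$ is a constant such that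 $\theta_{t,i}-\mathbb E_t[\theta_{t,i}]$ is $\sigma$ sub-Gaussian conditionally on $\mathcal F_t$ for every $i$, then almost surely the expectation and the mutual information in $\Gamma_t$ are finite and $\Gamma_t\le 2d\sigma^2/m^2$. -/

import Mathlib

open MeasureTheory ProbabilityTheory InformationTheory Set
open scoped ENNReal

noncomputable section

/-- The history before period `t`: the pairs `(A_s, Y_{s, A_s})` for `s < t`
(periods are numbered from `0`). -/
def banditHistory {Ω A 𝒴 : Type*} (act : ℕ → Ω → A) (Y : ℕ → A → Ω → 𝒴) (t : ℕ) (ω : Ω) :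
    Fin t → A × 𝒴 :=
  fun s => (act s ω, Y s (act s ω) ω)

/-- A Bayesian bandit problem together with a randomized policy, on a probability space `(Ω, μ)`,
with action set `A`, outcome space `𝒴` and space `𝒰` of external random seeds. -/
structure BanditModel {Ω : Type*} [MeasurableSpace Ω] (μ : Measure Ω)
    (A 𝒴 𝒰 : Type*) [MeasurableSpace A] [MeasurableSpace 𝒴] [MeasurableSpace 𝒰] where
  /-- the family of outcome distributions -/
  family : Set (Measure (A → 𝒴))
  family_prob : ∀ p ∈ family, IsProbabilityMeasure p
  /-- the (random) true outcome distribution `p*` -/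
  pstar : Ω → Measure (A → 𝒴)
  measurable_pstar : Measurable pstar
  pstar_mem : ∀ ω, pstar ω ∈ family
  /-- the outcome `Y_{t,a}` of action `a` in period `t` -/
  Y : ℕ → A → Ω → 𝒴
  measurable_Y : ∀ t a, Measurable (Y t a)
  /-- conditionally on `p*`, the vectors `Y_t = (Y_{t,a})_a` are i.i.d. with law `p*` -/
  cond_iid : ∀ (s : Finset ℕ) (B : ℕ → Set (A → 𝒴)) (C : Set (Measure (A → 𝒴))),
    (∀ t, MeasurableSet (B t)) → MeasurableSet C →
      μ (pstar ⁻¹' C ∩ ⋂ t ∈ s, {ω | (fun a => Y t a ω) ∈ B t}) =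
        ∫⁻ ω in pstar ⁻¹' C, ∏ t ∈ s, pstar ω (B t) ∂μ
  /-- the reward function -/
  R : 𝒴 → ℝ
  measurable_R : Measurable R
  /-- the optimal action, a function of `p*` that maximizes the mean reward under `p*` -/
  Astar : Ω → A
  measurable_Astar : Measurable[MeasurableSpace.comap pstar inferInstance] Astar
  optimal : ∀ᵐ ω ∂μ, ∀ a, ∫ y, R (y a) ∂(pstar ω) ≤ ∫ y, R (y (Astar ω)) ∂(pstar ω)
  /-- the external randomness -/
  U : ℕ → Ω → 𝒰
  measurable_U : ∀ t, Measurable (U t)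
  indep_U : ∀ t, IndepFun (U t)
    (fun ω => ((fun s : {s : ℕ // s ≠ t} => U s ω), (fun (s : ℕ) (a : A) => Y s a ω), pstar ω)) μ
  /-- the action taken in period `t`; it is a function of the history and of `U t` -/
  act : ℕ → Ω → A
  measurable_act : ∀ t, Measurable[MeasurableSpace.comap (banditHistory act Y t) inferInstance ⊔
    MeasurableSpace.comap (U t) inferInstance] (act t)

/-- The mutual information `I(X; Y)` under the base measure `P`: the Kullback--Leibler divergence
between the joint law and the product of the marginal laws. -/
def mutualInfo {S E F : Type*} [MeasurableSpace S] [MeasurableSpace E] [MeasurableSpace F]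
    (P : Measure S) (X : S → E) (Y : S → F) : ℝ≥0∞ :=
  klDiv (P.map (fun w => (X w, Y w))) ((P.map X).prod (P.map Y))

namespace BanditModel

variable {Ω : Type*} [MeasurableSpace Ω] {μ : Measure Ω} [IsFiniteMeasure μ]
  {A 𝒴 𝒰 : Type*} [Fintype A] [Nonempty A] [MeasurableSpace A] [DiscreteMeasurableSpace A]
  [MeasurableSpace 𝒴] [StandardBorelSpace 𝒴] [Nonempty 𝒴] [MeasurableSpace 𝒰]

/-- The history `(A_s, Y_{s, A_s})_{s < t}`. -/
def hist (M : BanditModel μ A 𝒴 𝒰) (t : ℕ) : Ω → Fin t → A × 𝒴 := banditHistory M.act M.Y t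

/-- The sigma-algebra `F_t` generated by the history. -/
abbrev histSigma (M : BanditModel μ A 𝒴 𝒰) (t : ℕ) : MeasurableSpace Ω :=
  MeasurableSpace.comap (M.hist t) inferInstance

/-- `P_t(X)`: the (regular) conditional law of the random variable `X` given `F_t`. -/
def condLaw (M : BanditModel μ A 𝒴 𝒰) (t : ℕ) {E : Type*} [MeasurableSpace E]
    [StandardBorelSpace E] [Nonempty E] (X : Ω → E) (ω : Ω) : Measure E :=
  condDistrib X (M.hist t) μ (M.hist t ω)

/-- The posterior measure `P_t` at `ω`, as the joint conditional law of `(A*, A_t, (Y_{t,a})_a)`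
given `F_t`. Under it a point is written `w = (a*, a, y)`, so that `A*` is `w.1`, `A_t` is `w.2.1`
and `Y_{t,a}` is `w.2.2 a`. -/
def posterior (M : BanditModel μ A 𝒴 𝒰) (t : ℕ) (ω : Ω) : Measure (A × A × (A → 𝒴)) :=
  M.condLaw t (fun ω' => (M.Astar ω', M.act t ω', fun a => M.Y t a ω')) ω

/-- The reward `R(Y_{t,a})`. -/
def reward (M : BanditModel μ A 𝒴 𝒰) (t : ℕ) (a : A) (ω : Ω) : ℝ := M.R (M.Y t a ω)

/-- `X - E[X | F_t]` is `σ` sub-Gaussian conditionally on `F_t`: for every real `l`,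
`E[exp (l (X - E[X | F_t])) | F_t] ≤ exp (l ^ 2 σ ^ 2 / 2)` almost surely (in particular the left
side is finite). The conditional expectations are integrals against the conditional law of `X`. -/
def CenteredSubGaussian (M : BanditModel μ A 𝒴 𝒰) (t : ℕ) (X : Ω → ℝ) (σ : Ω → ℝ) : Prop :=
  ∀ l : ℝ, ∀ᵐ ω ∂μ,
    Integrable (fun x => Real.exp (l * (x - ∫ z, z ∂(M.condLaw t X ω)))) (M.condLaw t X ω) ∧
    ∫ x, Real.exp (l * (x - ∫ z, z ∂(M.condLaw t X ω))) ∂(M.condLaw t X ω) ≤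
      Real.exp (l ^ 2 * σ ω ^ 2 / 2)

/-- The posterior measure `P_t( · | A* = a*)` at `ω`. -/
def posteriorGiven (M : BanditModel μ A 𝒴 𝒰) (t : ℕ) (astar : A) (ω : Ω) :
    Measure (A × A × (A → 𝒴)) :=
  ProbabilityTheory.cond (M.posterior t ω) {w | w.1 = astar}

/-- `D(P_t(Y_{t,a} | A* = a*) || P_t(Y_{t,a}))`. -/
def outcomeDiv (M : BanditModel μ A 𝒴 𝒰) (t : ℕ) (a astar : A) (ω : Ω) : ℝ≥0∞ :=
  klDiv ((M.posteriorGiven t astar ω).map (fun w => w.2.2 a))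
    ((M.posterior t ω).map (fun w => w.2.2 a))

/-- `R(Y_{t,A*}) - R(Y_{t,A_t})` as a random variable under the posterior measure. -/
def regretVar (M : BanditModel μ A 𝒴 𝒰) (w : A × A × (A → 𝒴)) : ℝ :=
  M.R (w.2.2 w.1) - M.R (w.2.2 w.2.1)

/-- The information gain `I_t(A*; (A_t, Y_{t,A_t}))`. -/
def infoGain (M : BanditModel μ A 𝒴 𝒰) (t : ℕ) (ω : Ω) : ℝ≥0∞ :=
  mutualInfo (M.posterior t ω) (fun w => w.1) (fun w => (w.2.1, w.2.2 w.2.1))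

/-- The information ratio `Γ_t`, with values in `[0, ∞]`; here `0 / 0 = 0` and `x / 0 = ∞` for
`x > 0`. -/
def infoRatio (M : BanditModel μ A 𝒴 𝒰) (t : ℕ) (ω : Ω) : ℝ≥0∞ :=
  ENNReal.ofReal ((∫ w, M.regretVar w ∂(M.posterior t ω)) ^ 2) / M.infoGain t ω

/-- The quantities in `Γ_t` are well defined and finite at `ω`, and `Γ_t ≤ c`. -/
def InfoRatioLE (M : BanditModel μ A 𝒴 𝒰) (t : ℕ) (c : ℝ) (ω : Ω) : Prop :=
  Integrable M.regretVar (M.posterior t ω) ∧ M.infoGain t ω ≠ ∞ ∧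
    M.infoRatio t ω ≤ ENNReal.ofReal c

/-- Thompson sampling: `P(A_t = a | F_t) = P(A* = a | F_t)`. -/
def IsThompsonSampling (M : BanditModel μ A 𝒴 𝒰) : Prop :=
  ∀ t a, ∀ᵐ ω ∂μ, M.posterior t ω {w | w.2.1 = a} = M.posterior t ω {w | w.1 = a}

/-- Full information in period `t`: the outcome `Y_{t,a}` is the pair `(a, Z)`. The outcome space
need not literally be `A × 𝒵`: the map `enc a` says how `(a, z)` is encoded as an outcome. -/
structure IsFullInformation (M : BanditModel μ A 𝒴 𝒰) (t : ℕ) {𝒵 : Type*} [MeasurableSpace 𝒵]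
    (Z : Ω → 𝒵) (enc : A → 𝒵 → 𝒴) : Prop where
  measurable_Z : Measurable Z
  enc_embedding : ∀ a, MeasurableEmbedding (enc a)
  outcome_eq : ∀ a ω, M.Y t a ω = enc a (Z ω)

/-- Linear bandit: action `a` has feature vector `φ a`, and under every `p` in the family the mean
rewards are linear in the features. -/
def IsLinear (M : BanditModel μ A 𝒴 𝒰) {d : ℕ} (φ : A → Fin d → ℝ) : Prop :=
  ∀ p ∈ M.family, ∃ θ : Fin d → ℝ, ∀ a, ∫ y, M.R (y a) ∂p = ∑ i, φ a i * θ i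

/-- Semi-bandit feedback in period `t`: action `a` is a subset `S a` of at most `m` of the `d`
items, its outcome is the vector `(θ_i : i ∈ S a)`, its reward is `m⁻¹ ∑_{i ∈ S a} θ_i`, and the
`θ_i` are independent conditionally on `F_t`. The map `enc a` says how a vector indexed by `S a` is
encoded as an outcome. -/
structure IsSemiBandit (M : BanditModel μ A 𝒴 𝒰) (t : ℕ) {d : ℕ} (m : ℕ)
    (S : A → Finset (Fin d)) (θ : Fin d → Ω → ℝ) (enc : (a : A) → (S a → ℝ) → 𝒴) : Prop where
  card_le : ∀ a, (S a).card ≤ m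
  measurable_θ : ∀ i, Measurable (θ i)
  enc_measurable : ∀ a, Measurable (enc a)
  enc_injective : ∀ a, Function.Injective (enc a)
  outcome_eq : ∀ a ω, M.Y t a ω = enc a (fun i => θ i ω)
  reward_eq : ∀ a x, M.R (enc a x) = (1 / (m : ℝ)) * ∑ i, x i
  cond_indep : ∀ᵐ ω ∂μ,
    iIndepFun (fun (i : Fin d) (x : Fin d → ℝ) => x i) (M.condLaw t (fun ω' i => θ i ω') ω)

end BanditModel

end

/-!
The Donsker–Varadhan inequality turns a sub-Gaussian bound into `(E_Q X)² ≤ 2σ² D(Q ‖ P)` for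
every `X` that is centred and `σ` sub-Gaussian under `P`; with `Q` the posterior given `A* = b`
this bounds the gap `g b a = E_t[R(Y_{t,a}) | A* = b] - E_t[R(Y_{t,a})]`.

Under `P_t` the action `A_t` is independent of `(A*, Y_t)` and, by probability matching, has the
law `q` of `A*`. Hence the expected regret is `∑ a, q a * g a a`, while Donsker–Varadhan applied to
the joint law of `A*` and `(A_t, Y_{t,A_t})` bounds the double average
`∑ b, ∑ a, q b * q a * (g b a)²` by `2σ²` times the information gain. The bounds on the information
ratio compare these two sums: by Cauchy–Schwarz over the actions in general; by Jensen's inequality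
when one outcome reveals all of them, since the gap of `b` can then be observed through any `a`; by
`(tr G)² ≤ rank G · ‖G‖²` for linear rewards; and under semi-bandit feedback by summing over items
instead of actions.

For a linear bandit the rank bound needs the posterior mean rewards, also given `A*`, to be linear
in the features. They are because, given `p*` and the history, `Y_t` still has law `p*`, so that
they are averages of the mean rewards under `p*`.
-/

open scoped NNReal

section Divergence

variable {α : Type*} [MeasurableSpace α] {P Q : Measure α}

lemma klDiv_ne_top_of_le_smul [IsFiniteMeasure Q] [IsFiniteMeasure P] {c : ℝ≥0∞} (hc : c ≠ ∞)
    (h : Q ≤ c • P) : klDiv Q P ≠ ∞ := by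
  have hac : Q ≪ P := Measure.absolutelyContinuous_of_le_smul h
  have hle : Q.rnDeriv P ≤ᵐ[P] fun _ => c := by
    refine ae_le_of_forall_setLIntegral_le_of_sigmaFinite (Measure.measurable_rnDeriv Q P)
      fun s _ _ => ?_
    rw [setLIntegral_const]
    exact (Measure.setLIntegral_rnDeriv_le s).trans (by simpa using h s)
  rw [klDiv_eq_lintegral_klFun_of_ac hac]
  refine ne_top_of_le_ne_top (b := ∫⁻ _, ENNReal.ofReal (c.toReal ^ 2 + 1) ∂P) ?_ ?_
  · rw [lintegral_const]
    exact ENNReal.mul_ne_top ENNReal.ofReal_ne_top (measure_ne_top _ _)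
  · refine lintegral_mono_ae ?_
    filter_upwards [hle] with x hx
    refine ENNReal.ofReal_le_ofReal ?_
    have hx' : (Q.rnDeriv P x).toReal ≤ c.toReal := ENNReal.toReal_mono hc hx
    have h0 : 0 ≤ (Q.rnDeriv P x).toReal := ENNReal.toReal_nonneg
    generalize (Q.rnDeriv P x).toReal = r at hx' h0
    rw [klFun_apply]
    rcases h0.eq_or_lt with rfl | hr
    · simp
    · nlinarith [mul_le_mul_of_nonneg_left (Real.log_le_sub_one_of_pos hr) h0]

-- The Donsker–Varadhan inequality: the divergence of `Q` from the tilted measure is nonnegative.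
lemma integral_le_toReal_klDiv [IsProbabilityMeasure Q] [IsProbabilityMeasure P]
    (hD : klDiv Q P ≠ ∞) {f : α → ℝ} (hfQ : Integrable f Q)
    (hfP : Integrable (fun x => Real.exp (f x)) P) (hexp : ∫ x, Real.exp (f x) ∂P ≤ 1) :
    ∫ x, f x ∂Q ≤ (klDiv Q P).toReal := by
  obtain ⟨hac, hint⟩ := klDiv_ne_top_iff.mp hD
  have hlog : Real.log (∫ x, Real.exp (f x) ∂P) ≤ 0 :=
    Real.log_nonpos (integral_nonneg fun x => (Real.exp_pos _).le) hexp
  have : IsProbabilityMeasure (P.tilted f) := isProbabilityMeasure_tilted hfP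
  have h := integral_llr_add_sub_measure_univ_nonneg
    (hac.trans (absolutelyContinuous_tilted hfP)) (integrable_llr_tilted_right hac hfQ hint hfP)
  rw [integral_llr_tilted_right hac hfQ hfP hint] at h
  simp only [probReal_univ] at h
  rw [toReal_klDiv_of_measure_eq hac (by simp)]
  linarith

lemma hasSubgaussianMGF_of_forall_rat {X : α → ℝ} {c : ℝ≥0}
    (h : ∀ q : ℚ, Integrable (fun x => Real.exp (q * X x)) P ∧
      ∫ x, Real.exp (q * X x) ∂P ≤ Real.exp (c * (q : ℝ) ^ 2 / 2)) :
    HasSubgaussianMGF X c P := by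
  have hint : ∀ t : ℝ, Integrable (fun x => Real.exp (t * X x)) P := by
    intro t
    obtain ⟨q, hq⟩ := exists_rat_gt t
    obtain ⟨r, hr⟩ := exists_rat_lt t
    exact integrable_exp_mul_of_le_of_le (h r).1 (h q).1 hr.le hq.le
  have hclosed : IsClosed {t : ℝ | mgf X P t ≤ Real.exp (c * t ^ 2 / 2)} :=
    isClosed_le (continuous_mgf hint) (by fun_prop)
  exact ⟨hint, fun t => Rat.denseRange_cast.induction_on t hclosed fun q => (h q).2⟩

lemma hasSubgaussianMGF_const_mul {X : α → ℝ} {c : ℝ≥0} (h : HasSubgaussianMGF X c P) (r : ℝ) :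
    HasSubgaussianMGF (fun x => r * X x) (‖r‖₊ ^ 2 * c) P := by
  have hr : ‖r‖₊ ^ 2 = ⟨r ^ 2, sq_nonneg r⟩ := by
    apply NNReal.eq
    rw [NNReal.coe_pow, coe_nnnorm, Real.norm_eq_abs, sq_abs]
    rfl
  rw [hr]
  exact h.const_mul r

lemma integral_exp_sub_half_le_one {X : α → ℝ} {c : ℝ≥0} (h : HasSubgaussianMGF X c P) :
    Integrable (fun x => Real.exp (X x - c / 2)) P ∧ ∫ x, Real.exp (X x - c / 2) ∂P ≤ 1 := by
  have hX : Integrable (fun x => Real.exp (X x)) P := by simpa using h.integrable_exp_mul 1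
  have hmgf : ∫ x, Real.exp (X x) ∂P ≤ Real.exp (c / 2) := by simpa [mgf] using h.mgf_le 1
  simp_rw [Real.exp_sub]
  refine ⟨hX.div_const _, ?_⟩
  rwa [integral_div, div_le_one (Real.exp_pos _)]

lemma le_two_mul_of_forall_quadratic_le {c S D : ℝ} (hc : 0 ≤ c) (hS : 0 ≤ S) (hD : 0 ≤ D)
    (h : ∀ k : ℝ, (k - k ^ 2 * c / 2) * S ≤ D) : S ≤ 2 * c * D := by
  rcases hS.eq_or_lt with rfl | hS
  · positivity
  rcases hc.eq_or_lt with rfl | hc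
  · have := h ((D + 1) / S)
    rw [mul_zero, zero_div, sub_zero, div_mul_cancel₀ _ hS.ne'] at this
    linarith
  · have := h (1 / c)
    have e : (1 / c - (1 / c) ^ 2 * c / 2) * S = S / (2 * c) := by field_simp; ring
    rw [e, div_le_iff₀ (by positivity)] at this
    linarith

lemma sq_integral_le_toReal_klDiv [IsProbabilityMeasure Q] [IsProbabilityMeasure P]
    (hD : klDiv Q P ≠ ∞) {X : α → ℝ} (hXQ : Integrable X Q) {c : ℝ≥0}
    (h : HasSubgaussianMGF X c P) : (∫ x, X x ∂Q) ^ 2 ≤ 2 * c * (klDiv Q P).toReal := by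
  refine le_two_mul_of_forall_quadratic_le c.2 (sq_nonneg _) ENNReal.toReal_nonneg fun k => ?_
  set l := k * ∫ x, X x ∂Q with hl
  obtain ⟨hint, hexp⟩ := integral_exp_sub_half_le_one (hasSubgaussianMGF_const_mul h l)
  have hi : Integrable (fun x => l * X x) Q := hXQ.const_mul l
  have := integral_le_toReal_klDiv hD (hi.sub (integrable_const _)) hint hexp
  rw [integral_sub' hi (integrable_const _), integral_const_mul] at this
  simp only [integral_const, probReal_univ, smul_eq_mul, one_mul, NNReal.coe_mul, NNReal.coe_pow,
    coe_nnnorm, Real.norm_eq_abs, sq_abs] at this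
  linear_combination this + (∫ x, X x ∂Q) * hl - (l + k * ∫ x, X x ∂Q) * (c / 2) * hl

end Divergence

section FiniteValued

variable {W A : Type*} [MeasurableSpace W] [MeasurableSpace A] [MeasurableSingletonClass A]
  {P : Measure W} {X : W → A}

lemma sum_restrict_preimage_singleton [Fintype A] (hX : Measurable X) :
    ∑ a, P.restrict (X ⁻¹' {a}) = P := by
  rw [← Measure.sum_fintype, ← Measure.restrict_iUnion (pairwise_disjoint_fiber X)
    fun a => hX (measurableSet_singleton a), ← preimage_iUnion, iUnion_of_singleton, preimage_univ,
    Measure.restrict_univ]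

variable {H : Type*} [NormedAddCommGroup H]

lemma integrable_apply_of_finite [Finite A] (hX : Measurable X) {f : A → W → H}
    (hf : ∀ a, Integrable (f a) P) : Integrable (fun w => f (X w) w) P := by
  cases nonempty_fintype A
  rw [← sum_restrict_preimage_singleton (P := P) hX, integrable_finsetSum_measure]
  intro a _
  refine IntegrableOn.congr_fun (f := f a) (hf a).integrableOn (fun w hw => ?_)
    (hX (measurableSet_singleton a))
  rw [show X w = a from hw]

lemma integral_apply_eq_sum_setIntegral [Fintype A] [NormedSpace ℝ H] (hX : Measurable X)
    {f : A → W → H} (hf : ∀ a, Integrable (f a) P) :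
    ∫ w, f (X w) w ∂P = ∑ a, ∫ w in X ⁻¹' {a}, f a w ∂P := by
  conv_lhs => rw [← sum_restrict_preimage_singleton (P := P) hX]
  rw [integral_finsetSum_measure fun a _ => (integrable_apply_of_finite hX hf).integrableOn]
  refine Finset.sum_congr rfl fun a _ => ?_
  refine setIntegral_congr_fun (hX (measurableSet_singleton a)) fun w hw => ?_
  simp only [show X w = a from hw]

lemma integral_eq_sum_setIntegral [Fintype A] [NormedSpace ℝ H] (hX : Measurable X) {f : W → H}
    (hf : Integrable f P) :
    ∫ w, f w ∂P = ∑ a, ∫ w in X ⁻¹' {a}, f w ∂P :=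
  integral_apply_eq_sum_setIntegral hX (f := fun _ => f) fun _ => hf

lemma sum_measureReal_preimage_singleton_univ [Fintype A] [IsProbabilityMeasure P]
    (hX : Measurable X) :
    ∑ a, P.real (X ⁻¹' {a}) = 1 := by
  simpa using (integral_eq_sum_setIntegral hX (integrable_const (μ := P) (1 : ℝ))).symm

lemma map_prodMk_apply_eq_sum [Fintype A] (hX : Measurable X) {E : Type*} [MeasurableSpace E]
    {Z : W → E} (hZ : Measurable Z) {s : Set (A × E)} (hs : MeasurableSet s) :
    P.map (fun w => (X w, Z w)) s = ∑ b, P (X ⁻¹' {b} ∩ Z ⁻¹' (Prod.mk b ⁻¹' s)) := by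
  rw [Measure.map_apply (hX.prodMk hZ) hs]
  conv_lhs => rw [← sum_restrict_preimage_singleton (P := P) hX, Measure.finsetSum_apply]
  refine Finset.sum_congr rfl fun b _ => ?_
  rw [Measure.restrict_apply (hX.prodMk hZ hs), inter_comm]
  congr 1
  ext w
  refine and_congr_right fun (hw : X w = b) => ?_
  simp [← hw]

-- The joint law is at most `∑ b, P(X = b)⁻¹` times the product of the marginals.
lemma mutualInfo_ne_top [Finite A] [IsProbabilityMeasure P] {E : Type*} [MeasurableSpace E]
    (hX : Measurable X) {Z : W → E} (hZ : Measurable Z) : mutualInfo P X Z ≠ ∞ := by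
  cases nonempty_fintype A
  classical
  have := Measure.isProbabilityMeasure_map (μ := P) hX.aemeasurable
  have := Measure.isProbabilityMeasure_map (μ := P) hZ.aemeasurable
  have := Measure.isProbabilityMeasure_map (μ := P) (hX.prodMk hZ).aemeasurable
  let u : A → ℝ≥0∞ := fun b => if P (X ⁻¹' {b}) = 0 then 0 else (P (X ⁻¹' {b}))⁻¹
  have hu : ∀ b, u b ≠ ∞ := by
    intro b
    by_cases h : P (X ⁻¹' {b}) = 0 <;> simp [u, h]
  refine klDiv_ne_top_of_le_smul (c := ∑ b, u b) (by simp [ENNReal.sum_eq_top, hu])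
    (Measure.le_iff.mpr fun s hs => ?_)
  have hprod : ((P.map X).prod (P.map Z)) s =
      ∑ b, P (X ⁻¹' {b}) * P (Z ⁻¹' (Prod.mk b ⁻¹' s)) := by
    rw [Measure.prod_apply hs, lintegral_fintype]
    refine Finset.sum_congr rfl fun b _ => ?_
    rw [Measure.map_apply hX (measurableSet_singleton b),
      Measure.map_apply hZ (measurable_prodMk_left hs), mul_comm]
  rw [Measure.smul_apply, smul_eq_mul, map_prodMk_apply_eq_sum hX hZ hs, hprod, Finset.mul_sum]
  refine Finset.sum_le_sum fun b _ => ?_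
  by_cases h : P (X ⁻¹' {b}) = 0
  · simp [measure_inter_null_of_null_left _ h]
  · have hub : 1 ≤ (∑ b', u b') * P (X ⁻¹' {b}) := by
      rw [← ENNReal.inv_mul_cancel h (measure_ne_top _ _)]
      gcongr
      rw [show (P (X ⁻¹' {b}))⁻¹ = u b by simp [u, h]]
      exact Finset.single_le_sum (fun _ _ => zero_le) (Finset.mem_univ b)
    calc P (X ⁻¹' {b} ∩ Z ⁻¹' (Prod.mk b ⁻¹' s))
        ≤ 1 * P (Z ⁻¹' (Prod.mk b ⁻¹' s)) := by rw [one_mul]; exact measure_mono inter_subset_right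
      _ ≤ _ := by rw [← mul_assoc]; gcongr

lemma sum_setIntegral_le_toReal_mutualInfo [Fintype A] [IsProbabilityMeasure P] {E : Type*}
    [MeasurableSpace E] (hX : Measurable X) {Z : W → E} (hZ : Measurable Z) {F : A → E → ℝ}
    (hF : ∀ b, Measurable (F b)) (hint : ∀ b, Integrable (fun w => F b (Z w)) P)
    (hexp : ∀ b, Integrable (fun w => Real.exp (F b (Z w))) P)
    (hle : ∀ b, ∫ w, Real.exp (F b (Z w)) ∂P ≤ 1) :
    ∑ b, ∫ w in X ⁻¹' {b}, F b (Z w) ∂P ≤ (mutualInfo P X Z).toReal := by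
  have hXZ : Measurable fun w => (X w, Z w) := hX.prodMk hZ
  have := Measure.isProbabilityMeasure_map (μ := P) hX.aemeasurable
  have := Measure.isProbabilityMeasure_map (μ := P) hZ.aemeasurable
  have := Measure.isProbabilityMeasure_map (μ := P) hXZ.aemeasurable
  have hFm : Measurable fun q : A × E => F q.1 q.2 := measurable_from_prod_countable_right hF
  have hFint : Integrable (fun q : A × E => F q.1 q.2) (P.map fun w => (X w, Z w)) :=
    (integrable_map_measure hFm.aestronglyMeasurable hXZ.aemeasurable).mpr
      (integrable_apply_of_finite hX hint)
  have hZexp : ∀ b, Integrable (fun z => Real.exp (F b z)) (P.map Z) := fun b =>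
    (integrable_map_measure (hF b).exp.aestronglyMeasurable hZ.aemeasurable).mpr (hexp b)
  have hprod : Integrable (fun q : A × E => Real.exp (F q.1 q.2)) ((P.map X).prod (P.map Z)) :=
    (integrable_prod_iff hFm.exp.aestronglyMeasurable).mpr ⟨ae_of_all _ hZexp, .of_finite⟩
  have hprod_le : ∫ q : A × E, Real.exp (F q.1 q.2) ∂((P.map X).prod (P.map Z)) ≤ 1 := by
    rw [integral_prod _ hprod]
    calc ∫ b, ∫ z, Real.exp (F b z) ∂(P.map Z) ∂(P.map X)
        ≤ ∫ _, 1 ∂(P.map X) := by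
          refine integral_mono .of_finite (integrable_const _) fun b => ?_
          simpa [integral_map hZ.aemeasurable (hF b).exp.aestronglyMeasurable] using hle b
      _ = 1 := by simp
  have := integral_le_toReal_klDiv (mutualInfo_ne_top hX hZ) hFint hprod hprod_le
  rwa [integral_map hXZ.aemeasurable hFm.aestronglyMeasurable,
    integral_apply_eq_sum_setIntegral hX hint] at this

end FiniteValued

-- The matrix inequality `(tr v)² ≤ rank v · ‖v‖²`: expand the rows in an orthonormal basis of `V`
-- and apply Cauchy–Schwarz.
lemma sq_sum_apply_self_le_of_finrank_le {ι : Type*} [Fintype ι] {d : ℕ}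
    {V : Submodule ℝ (EuclideanSpace ℝ ι)} (hV : Module.finrank ℝ V ≤ d)
    {v : ι → EuclideanSpace ℝ ι} (hv : ∀ a, v a ∈ V) :
    (∑ a, v a a) ^ 2 ≤ d * ∑ a, ∑ b, v a b ^ 2 := by
  let u := stdOrthonormalBasis ℝ V
  have hcoord : ∀ a, v a a = ∑ j, u.repr ⟨v a, hv a⟩ j * (u j : EuclideanSpace ℝ ι) a := by
    intro a
    simpa using congrArg (fun x : V => (x : EuclideanSpace ℝ ι) a) (u.sum_repr ⟨v a, hv a⟩).symm
  have hnorm : ∀ a, ∑ j, u.repr ⟨v a, hv a⟩ j ^ 2 = ∑ b, v a b ^ 2 := by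
    intro a
    have h : ‖u.repr ⟨v a, hv a⟩‖ ^ 2 = ‖v a‖ ^ 2 := by rw [LinearIsometryEquiv.norm_map]; rfl
    simpa only [EuclideanSpace.norm_sq_eq, Real.norm_eq_abs, sq_abs] using h
  have hu : ∀ j, ∑ a, (u j : EuclideanSpace ℝ ι) a ^ 2 = 1 := by
    intro j
    have h : ‖(u j : EuclideanSpace ℝ ι)‖ ^ 2 = 1 := by
      rw [← Submodule.coe_norm, u.orthonormal.1 j, one_pow]
    simpa only [EuclideanSpace.norm_sq_eq, Real.norm_eq_abs, sq_abs] using h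
  calc (∑ a, v a a) ^ 2
      = (∑ p : ι × Fin (Module.finrank ℝ V), u.repr ⟨v p.1, hv p.1⟩ p.2 *
          (u p.2 : EuclideanSpace ℝ ι) p.1) ^ 2 := by
        simp_rw [Fintype.sum_prod_type, hcoord]
    _ ≤ (∑ p : ι × Fin (Module.finrank ℝ V), u.repr ⟨v p.1, hv p.1⟩ p.2 ^ 2) *
          ∑ p : ι × Fin (Module.finrank ℝ V), (u p.2 : EuclideanSpace ℝ ι) p.1 ^ 2 :=
        Finset.sum_mul_sq_le_sq_mul_sq _ _ _
    _ = (∑ a, ∑ b, v a b ^ 2) * Module.finrank ℝ V := by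
        rw [Fintype.sum_prod_type, Fintype.sum_prod_type_right]
        simp [hnorm, hu]
    _ ≤ (∑ a, ∑ b, v a b ^ 2) * d := by gcongr
    _ = _ := mul_comm _ _

/-- Probability matching under `P`: the action `act` is independent of the pair formed by the
optimal action `opt` and the outcome vector `(Y a)_a`, and it has the same law as `opt`. This is
what Thompson sampling achieves under every posterior measure. -/
structure IsProbabilityMatching {W A 𝒴 : Type*} [MeasurableSpace W] [MeasurableSpace A]
    [MeasurableSpace 𝒴] (P : Measure W) (opt act : W → A) (Y : A → W → 𝒴) : Prop where
  measurable_opt : Measurable opt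
  measurable_act : Measurable act
  measurable_outcome : ∀ a, Measurable (Y a)
  indepFun : IndepFun act (fun w => (opt w, fun a => Y a w)) P
  measure_eq : ∀ a, P (act ⁻¹' {a}) = P (opt ⁻¹' {a})

namespace IsProbabilityMatching

section Freezing

variable {W A 𝒴 : Type*} [MeasurableSpace A] [MeasurableSpace 𝒴] {opt act : W → A}
  {Y : A → W → 𝒴}

lemma comap_outcome_le (a : A) : MeasurableSpace.comap (Y a) inferInstance ≤
    MeasurableSpace.comap (fun w => (opt w, fun a => Y a w)) inferInstance := by
  have : Y a = (fun q : A × (A → 𝒴) => q.2 a) ∘ fun w => (opt w, fun a => Y a w) := rfl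
  rw [this, ← MeasurableSpace.comap_comp]
  exact MeasurableSpace.comap_mono (Measurable.comap_le (by fun_prop))

variable [MeasurableSpace W] {P : Measure W} [MeasurableSingletonClass A]

lemma setIntegral_act (h : IsProbabilityMatching P opt act Y) (a : A) {g : W → ℝ}
    (hg : Measurable[MeasurableSpace.comap (fun w => (opt w, fun a => Y a w)) inferInstance] g) :
    ∫ w in act ⁻¹' {a}, g w ∂P = P.real (opt ⁻¹' {a}) * ∫ w, g w ∂P := by
  have hV : Measurable fun w => (opt w, fun a => Y a w) :=
    h.measurable_opt.prodMk (measurable_pi_lambda _ h.measurable_outcome)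
  have hreal : P.real (act ⁻¹' {a}) = P.real (opt ⁻¹' {a}) := by
    simp only [measureReal_def, h.measure_eq]
  rw [← hreal]
  exact Indep.setIntegral_eq_mul (f := id) h.measurable_act.comap_le
    (indep_of_indep_of_le_right h.indepFun hg.comap_le) (hg.mono hV.comap_le le_rfl).aemeasurable
    ⟨{a}, measurableSet_singleton a, rfl⟩ aestronglyMeasurable_id

variable [Fintype A]

lemma integral_apply_act (h : IsProbabilityMatching P opt act Y) {f : A → W → ℝ}
    (hf : ∀ a,
      Measurable[MeasurableSpace.comap (fun w => (opt w, fun a => Y a w)) inferInstance] (f a))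
    (hint : ∀ a, Integrable (f a) P) :
    ∫ w, f (act w) w ∂P = ∑ a, P.real (opt ⁻¹' {a}) * ∫ w, f a w ∂P := by
  rw [integral_apply_eq_sum_setIntegral h.measurable_act hint]
  exact Finset.sum_congr rfl fun a _ => h.setIntegral_act a (hf a)

lemma setIntegral_opt_apply_act (h : IsProbabilityMatching P opt act Y) (b : A) {f : A → W → ℝ}
    (hf : ∀ a, Measurable[MeasurableSpace.comap (Y a) inferInstance] (f a))
    (hint : ∀ a, Integrable (f a) P) :
    ∫ w in opt ⁻¹' {b}, f (act w) w ∂P =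
      ∑ a, P.real (opt ⁻¹' {a}) * ∫ w in opt ⁻¹' {b}, f a w ∂P := by
  have hb := h.measurable_opt (measurableSet_singleton b)
  have hmeas : MeasurableSet[MeasurableSpace.comap (fun w => (opt w, fun a => Y a w))
      inferInstance] (opt ⁻¹' {b}) :=
    ⟨Prod.fst ⁻¹' {b}, measurable_fst (measurableSet_singleton b), rfl⟩
  simp_rw [← integral_indicator hb]
  exact h.integral_apply_act (f := fun a => (opt ⁻¹' {b}).indicator (f a))
    (fun a => ((hf a).mono (comap_outcome_le a) le_rfl).indicator hmeas)
    fun a => (hint a).indicator hb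

lemma integral_regret [IsFiniteMeasure P] (h : IsProbabilityMatching P opt act Y) {X : A → W → ℝ}
    (hX : ∀ a, Measurable[MeasurableSpace.comap (Y a) inferInstance] (X a))
    (hint : ∀ a, Integrable (X a) P) :
    ∫ w, (X (opt w) w - X (act w) w) ∂P =
      ∑ a, ∫ w in opt ⁻¹' {a}, (X a w - ∫ z, X a z ∂P) ∂P := by
  rw [integral_sub (integrable_apply_of_finite h.measurable_opt hint)
      (integrable_apply_of_finite h.measurable_act hint),
    integral_apply_eq_sum_setIntegral h.measurable_opt hint,
    h.integral_apply_act (fun a => (hX a).mono (comap_outcome_le a) le_rfl) hint,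
    ← Finset.sum_sub_distrib]
  refine Finset.sum_congr rfl fun a _ => ?_
  rw [integral_sub (hint a).integrableOn (integrable_const _), setIntegral_const,
    smul_eq_mul]

end Freezing

section Information

variable {W A 𝒴 : Type*} [MeasurableSpace W] [Fintype A] [MeasurableSpace A]
  [MeasurableSingletonClass A] [MeasurableSpace 𝒴] {P : Measure W} [IsProbabilityMeasure P]
  {opt act : W → A} {Y : A → W → 𝒴}

-- Apply the variational bound to the functional `f b a - c b a / 2` of `(b, a, Y a)`.
lemma sum_le_toReal_mutualInfo (h : IsProbabilityMatching P opt act Y) {f : A → A → W → ℝ}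
    {c : A → A → ℝ≥0} (hf : ∀ b a, Measurable[MeasurableSpace.comap (Y a) inferInstance] (f b a))
    (hsub : ∀ b a, HasSubgaussianMGF (f b a) (c b a) P) :
    ∑ b, ∑ a, P.real (opt ⁻¹' {a}) *
        (∫ w in opt ⁻¹' {b}, f b a w ∂P - P.real (opt ⁻¹' {b}) * (c b a / 2)) ≤
      (mutualInfo P opt fun w => (act w, Y (act w) w)).toReal := by
  choose F hF hfF using fun b a => (hf b a).exists_eq_measurable_comp
  let G : A → A × 𝒴 → ℝ := fun b z => F b z.1 z.2 - c b z.1 / 2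
  have hG : ∀ b, Measurable (G b) := fun b =>
    measurable_from_prod_countable_right fun a => (hF b a).sub_const (c b a / 2 : ℝ)
  have hGf : ∀ b w, G b (act w, Y (act w) w) = f b (act w) w - c b (act w) / 2 := by
    simp [G, hfF]
  have hZ : Measurable fun w => (act w, Y (act w) w) := by
    have : Measurable fun q : A × W => Y q.1 q.2 :=
      measurable_from_prod_countable_right h.measurable_outcome
    exact h.measurable_act.prodMk (this.comp (h.measurable_act.prodMk measurable_id))
  have hmeas : ∀ b a, Measurable[MeasurableSpace.comap (Y a) inferInstance]
      fun w => f b a w - c b a / 2 := fun b a => (hf b a).sub_const _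
  have hint : ∀ b a, Integrable (fun w => f b a w - c b a / 2) P := fun b a =>
    (hsub b a).integrable.sub (integrable_const _)
  have hexp := fun b a => integral_exp_sub_half_le_one (hsub b a)
  have hexp_le : ∀ b, ∫ w, Real.exp (f b (act w) w - c b (act w) / 2) ∂P ≤ 1 := by
    intro b
    rw [h.integral_apply_act (f := fun a w => Real.exp (f b a w - c b a / 2))
      (fun a => ((hmeas b a).mono (comap_outcome_le a) le_rfl).exp) fun a => (hexp b a).1]
    calc ∑ a, P.real (opt ⁻¹' {a}) * ∫ w, Real.exp (f b a w - c b a / 2) ∂P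
        ≤ ∑ a, P.real (opt ⁻¹' {a}) := Finset.sum_le_sum fun a _ =>
          mul_le_of_le_one_right measureReal_nonneg (hexp b a).2
      _ = 1 := sum_measureReal_preimage_singleton_univ h.measurable_opt
  have key := sum_setIntegral_le_toReal_mutualInfo h.measurable_opt hZ hG
    (fun b => by simpa only [hGf] using integrable_apply_of_finite h.measurable_act (hint b))
    (fun b => by
      simpa only [hGf] using integrable_apply_of_finite h.measurable_act fun a => (hexp b a).1)
    fun b => by simpa only [hGf] using hexp_le b
  refine le_of_eq_of_le (Finset.sum_congr rfl fun b _ => ?_) key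
  simp only [hGf]
  rw [h.setIntegral_opt_apply_act b (f := fun a w => f b a w - c b a / 2) (hmeas b) (hint b)]
  refine Finset.sum_congr rfl fun a _ => ?_
  rw [integral_sub (hsub b a).integrable.integrableOn (integrable_const _), setIntegral_const,
    smul_eq_mul]

lemma sum_sq_setAverage_le (h : IsProbabilityMatching P opt act Y) {f : A → A → W → ℝ} {c : ℝ≥0}
    (hf : ∀ b a, Measurable[MeasurableSpace.comap (Y a) inferInstance] (f b a))
    (hsub : ∀ b a, HasSubgaussianMGF (f b a) c P) :
    ∑ b, ∑ a, P.real (opt ⁻¹' {b}) * P.real (opt ⁻¹' {a}) *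
        (⨍ w in opt ⁻¹' {b}, f b a w ∂P) ^ 2 ≤
      2 * c * (mutualInfo P opt fun w => (act w, Y (act w) w)).toReal := by
  refine le_two_mul_of_forall_quadratic_le c.2 (by positivity) ENNReal.toReal_nonneg fun k => ?_
  let g : A → A → ℝ := fun b a => ⨍ w in opt ⁻¹' {b}, f b a w ∂P
  refine le_of_eq_of_le ?_ (h.sum_le_toReal_mutualInfo (f := fun b a w => k * g b a * f b a w)
    (fun b a => (hf b a).const_mul _) fun b a => hasSubgaussianMGF_const_mul (hsub b a) _)
  simp only [Finset.mul_sum]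
  refine Finset.sum_congr rfl fun b _ => Finset.sum_congr rfl fun a _ => ?_
  rw [integral_const_mul, ← measure_smul_setAverage _ (measure_ne_top _ _), smul_eq_mul]
  simp only [NNReal.coe_mul, NNReal.coe_pow, coe_nnnorm, Real.norm_eq_abs, sq_abs]
  change _ = _ * (k * g b a * (_ * g b a) - _)
  change _ * (_ * g b a ^ 2) = _
  ring

lemma sq_sum_setIntegral_le_card (h : IsProbabilityMatching P opt act Y) {X : A → W → ℝ}
    {c : ℝ≥0} (hX : ∀ a, Measurable[MeasurableSpace.comap (Y a) inferInstance] (X a))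
    (hsub : ∀ a, HasSubgaussianMGF (X a) c P) :
    (∑ a, ∫ w in opt ⁻¹' {a}, X a w ∂P) ^ 2 ≤
      2 * Fintype.card A * c * (mutualInfo P opt fun w => (act w, Y (act w) w)).toReal := by
  calc (∑ a, ∫ w in opt ⁻¹' {a}, X a w ∂P) ^ 2
      ≤ Fintype.card A * ∑ a, (∫ w in opt ⁻¹' {a}, X a w ∂P) ^ 2 := sq_sum_le_card_mul_sum_sq
    _ = Fintype.card A * ∑ a, P.real (opt ⁻¹' {a}) * P.real (opt ⁻¹' {a}) *
          (⨍ w in opt ⁻¹' {a}, X a w ∂P) ^ 2 := by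
        simp_rw [← measure_smul_setAverage _ (measure_ne_top P _), smul_eq_mul, mul_pow, sq]
    _ ≤ Fintype.card A * ∑ b, ∑ a, P.real (opt ⁻¹' {b}) * P.real (opt ⁻¹' {a}) *
          (⨍ w in opt ⁻¹' {b}, X a w ∂P) ^ 2 := by
        gcongr with a
        exact Finset.single_le_sum (f := fun a' => P.real (opt ⁻¹' {a}) * P.real (opt ⁻¹' {a'}) *
          (⨍ w in opt ⁻¹' {a}, X a' w ∂P) ^ 2) (fun _ _ => by positivity) (Finset.mem_univ a)
    _ ≤ Fintype.card A * (2 * c * (mutualInfo P opt fun w => (act w, Y (act w) w)).toReal) := by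
        gcongr
        exact h.sum_sq_setAverage_le (fun _ => hX) fun _ => hsub
    _ = _ := by ring

lemma sq_sum_setIntegral_le_of_measurable_comap (h : IsProbabilityMatching P opt act Y)
    {X : A → W → ℝ} {c : ℝ≥0}
    (hX : ∀ b a, Measurable[MeasurableSpace.comap (Y a) inferInstance] (X b))
    (hsub : ∀ a, HasSubgaussianMGF (X a) c P) :
    (∑ a, ∫ w in opt ⁻¹' {a}, X a w ∂P) ^ 2 ≤
      2 * c * (mutualInfo P opt fun w => (act w, Y (act w) w)).toReal := by
  have hsum := sum_measureReal_preimage_singleton_univ (P := P) h.measurable_opt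
  have hsq := h.sum_sq_setAverage_le (f := fun b _ => X b) hX fun b _ => hsub b
  simp_rw [← Finset.sum_mul, ← Finset.mul_sum, hsum, mul_one] at hsq
  refine le_trans ?_ hsq
  calc (∑ b, ∫ w in opt ⁻¹' {b}, X b w ∂P) ^ 2
      = (∑ b, P.real (opt ⁻¹' {b}) * ⨍ w in opt ⁻¹' {b}, X b w ∂P) ^ 2 := by
        simp_rw [← measure_smul_setAverage _ (measure_ne_top P _), smul_eq_mul]
    _ ≤ (∑ b, P.real (opt ⁻¹' {b})) *
          ∑ b, P.real (opt ⁻¹' {b}) * (⨍ w in opt ⁻¹' {b}, X b w ∂P) ^ 2 :=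
        Finset.sum_sq_le_sum_mul_sum_of_sq_le_mul _ (fun _ _ => measureReal_nonneg)
          (fun _ _ => by positivity) fun _ _ => le_of_eq (by ring)
    _ = _ := by rw [hsum, one_mul]

-- After scaling by the square roots of the probabilities, the averages form a matrix of rank at
-- most `d` whose trace is the left-hand side.
lemma sq_sum_setIntegral_le_of_mem_submodule (h : IsProbabilityMatching P opt act Y)
    {X : A → W → ℝ} {c : ℝ≥0}
    (hX : ∀ a, Measurable[MeasurableSpace.comap (Y a) inferInstance] (X a))
    (hsub : ∀ a, HasSubgaussianMGF (X a) c P) {d : ℕ} {V : Submodule ℝ (EuclideanSpace ℝ A)}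
    (hV : Module.finrank ℝ V ≤ d)
    (hmem : ∀ b, WithLp.toLp 2 (fun a => ∫ w in opt ⁻¹' {b}, X a w ∂P) ∈ V) :
    (∑ a, ∫ w in opt ⁻¹' {a}, X a w ∂P) ^ 2 ≤
      2 * d * c * (mutualInfo P opt fun w => (act w, Y (act w) w)).toReal := by
  let s : A → ℝ := fun a => √(P.real (opt ⁻¹' {a}))
  have hs : ∀ a, s a * s a = P.real (opt ⁻¹' {a}) := fun a =>
    Real.mul_self_sqrt measureReal_nonneg
  let D : EuclideanSpace ℝ A →ₗ[ℝ] EuclideanSpace ℝ A :=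
    { toFun := fun x => WithLp.toLp 2 fun a => s a * x a
      map_add' := fun x y => by ext a; simp [mul_add]
      map_smul' := fun r x => by ext a; simp [mul_left_comm] }
  let v : A → EuclideanSpace ℝ A := fun b =>
    WithLp.toLp 2 fun a => s b * (s a * ⨍ w in opt ⁻¹' {b}, X a w ∂P)
  have hv : ∀ b, v b ∈ V.map D := by
    intro b
    refine ⟨_, V.smul_mem (s b * (P.real (opt ⁻¹' {b}))⁻¹) (hmem b), ?_⟩
    ext a
    simp only [D, v, LinearMap.coe_mk, AddHom.coe_mk, PiLp.smul_apply, smul_eq_mul, setAverage_eq]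
    ring
  calc (∑ a, ∫ w in opt ⁻¹' {a}, X a w ∂P) ^ 2
      = (∑ a, v a a) ^ 2 := by
        simp_rw [← measure_smul_setAverage _ (measure_ne_top P _), smul_eq_mul, v, ← mul_assoc, hs]
    _ ≤ d * ∑ b, ∑ a, v b a ^ 2 :=
        sq_sum_apply_self_le_of_finrank_le ((Submodule.finrank_map_le D V).trans hV) hv
    _ = d * ∑ b, ∑ a, P.real (opt ⁻¹' {b}) * P.real (opt ⁻¹' {a}) *
          (⨍ w in opt ⁻¹' {b}, X a w ∂P) ^ 2 := by
        simp_rw [← hs]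
        congr! 5
        simp only [v]
        ring
    _ ≤ d * (2 * c * (mutualInfo P opt fun w => (act w, Y (act w) w)).toReal) := by
        gcongr
        exact h.sum_sq_setAverage_le (fun _ => hX) fun _ => hsub
    _ = _ := by ring

-- The functional of `(b, a)` is supported on the items common to `b` and `a`, those which are both
-- relevant to the reward of `b` and observed when playing `a`.
lemma sum_items_le_toReal_mutualInfo (h : IsProbabilityMatching P opt act Y) {ι : Type*}
    [Fintype ι] [DecidableEq ι] {S : A → Finset ι} {θ : ι → W → ℝ} {c : ℝ≥0}
    (hθ : ∀ a, ∀ i ∈ S a, Measurable[MeasurableSpace.comap (Y a) inferInstance] (θ i))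
    (hind : iIndepFun θ P) (hsub : ∀ i, HasSubgaussianMGF (θ i) c P) (l : ι → ℝ) :
    ∑ i, (∑ a with i ∈ S a, P.real (opt ⁻¹' {a})) *
        (l i * (∑ b with i ∈ S b, ∫ w in opt ⁻¹' {b}, θ i w ∂P) -
          (∑ b with i ∈ S b, P.real (opt ⁻¹' {b})) * (l i ^ 2 * c / 2)) ≤
      (mutualInfo P opt fun w => (act w, Y (act w) w)).toReal := by
  have hmeas : ∀ b a, Measurable[MeasurableSpace.comap (Y a) inferInstance]
      fun w => ∑ i ∈ S b ∩ S a, l i * θ i w := fun b a =>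
    Finset.measurable_fun_sum _ fun i hi => (hθ a i (Finset.mem_inter.mp hi).2).const_mul _
  have hfsub : ∀ b a, HasSubgaussianMGF (fun w => ∑ i ∈ S b ∩ S a, l i * θ i w)
      (∑ i ∈ S b ∩ S a, ‖l i‖₊ ^ 2 * c) P := fun b a =>
    .sum_of_iIndepFun (hind.comp (fun i x => l i * x) fun i => measurable_const_mul _)
      fun i _ => hasSubgaussianMGF_const_mul (hsub i) _
  refine le_of_eq_of_le ?_ (h.sum_le_toReal_mutualInfo hmeas hfsub)
  have hterm : ∀ b a, P.real (opt ⁻¹' {a}) *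
      (∫ w in opt ⁻¹' {b}, ∑ i ∈ S b ∩ S a, l i * θ i w ∂P -
        P.real (opt ⁻¹' {b}) * ((∑ i ∈ S b ∩ S a, ‖l i‖₊ ^ 2 * c : ℝ≥0) / 2)) =
      ∑ i, if i ∈ S b then if i ∈ S a then P.real (opt ⁻¹' {a}) *
        (l i * ∫ w in opt ⁻¹' {b}, θ i w ∂P - P.real (opt ⁻¹' {b}) * (l i ^ 2 * c / 2))
        else 0 else 0 := by
    intro b a
    rw [integral_finsetSum _ fun i _ => ((hsub i).integrable.const_mul _).integrableOn]
    simp only [integral_const_mul, NNReal.coe_sum, NNReal.coe_mul, NNReal.coe_pow, coe_nnnorm,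
      Real.norm_eq_abs, sq_abs, ← ite_and, ← Finset.mem_inter, Finset.sum_ite_mem,
      Finset.univ_inter]
    rw [Finset.sum_div, Finset.mul_sum, ← Finset.sum_sub_distrib, Finset.mul_sum]
  simp_rw [hterm]
  simp_rw [Finset.sum_comm (s := Finset.univ (α := A)) (t := Finset.univ (α := ι))]
  refine Finset.sum_congr rfl fun i _ => ?_
  rw [Finset.mul_sum _ _ (l i), Finset.sum_mul _ _ (l i ^ 2 * c / 2), ← Finset.sum_sub_distrib,
    Finset.sum_mul_sum, Finset.sum_comm]
  simp only [Finset.sum_filter, Finset.sum_ite_irrel, Finset.sum_const_zero]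

lemma sq_sum_setIntegral_le_items (h : IsProbabilityMatching P opt act Y) {ι : Type*}
    [Fintype ι] {S : A → Finset ι} {θ : ι → W → ℝ} {c : ℝ≥0}
    (hθ : ∀ a, ∀ i ∈ S a, Measurable[MeasurableSpace.comap (Y a) inferInstance] (θ i))
    (hind : iIndepFun θ P) (hsub : ∀ i, HasSubgaussianMGF (θ i) c P) :
    (∑ a, ∫ w in opt ⁻¹' {a}, ∑ i ∈ S a, θ i w ∂P) ^ 2 ≤
      2 * Fintype.card ι * c * (mutualInfo P opt fun w => (act w, Y (act w) w)).toReal := by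
  classical
  let q : ι → ℝ := fun i => ∑ a with i ∈ S a, P.real (opt ⁻¹' {a})
  let G : ι → ℝ := fun i => ∑ a with i ∈ S a, ∫ w in opt ⁻¹' {a}, θ i w ∂P
  have hGq : ∀ i, q i * (G i / q i) = G i := by
    intro i
    refine mul_div_cancel_of_imp' fun hq => Finset.sum_eq_zero fun a ha => ?_
    have hpa := (Finset.sum_eq_zero_iff_of_nonneg fun _ _ => measureReal_nonneg).mp hq a ha
    exact setIntegral_measure_zero _ ((measureReal_eq_zero_iff (measure_ne_top _ _)).mp hpa)
  have hG : ∑ i, G i ^ 2 ≤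
      2 * c * (mutualInfo P opt fun w => (act w, Y (act w) w)).toReal := by
    refine le_two_mul_of_forall_quadratic_le c.2 (by positivity) ENNReal.toReal_nonneg
      fun k => ?_
    refine le_of_eq_of_le ?_
      (h.sum_items_le_toReal_mutualInfo hθ hind hsub fun i => k * (G i / q i))
    rw [Finset.mul_sum]
    refine Finset.sum_congr rfl fun i _ => ?_
    change _ = q i * (k * (G i / q i) * G i - q i * ((k * (G i / q i)) ^ 2 * c / 2))
    linear_combination (-k * G i + k ^ 2 * c / 2 * (q i * (G i / q i) + G i)) * hGq i
  have hsum : ∑ a, ∫ w in opt ⁻¹' {a}, ∑ i ∈ S a, θ i w ∂P = ∑ i, G i := by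
    simp_rw [G, Finset.sum_filter]
    rw [Finset.sum_comm]
    refine Finset.sum_congr rfl fun a _ => ?_
    rw [integral_finsetSum _ fun i _ => (hsub i).integrable.integrableOn, Finset.sum_ite_mem,
      Finset.univ_inter]
  calc (∑ a, ∫ w in opt ⁻¹' {a}, ∑ i ∈ S a, θ i w ∂P) ^ 2
      = (∑ i, G i) ^ 2 := by rw [hsum]
    _ ≤ Fintype.card ι * ∑ i, G i ^ 2 := sq_sum_le_card_mul_sum_sq
    _ ≤ Fintype.card ι *
          (2 * c * (mutualInfo P opt fun w => (act w, Y (act w) w)).toReal) := by gcongr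
    _ = _ := by ring

end Information

end IsProbabilityMatching

section ConditionalIndependence

variable {Ω E F G V : Type*} [MeasurableSpace Ω] [MeasurableSpace E] [MeasurableSpace F]
  [MeasurableSpace G] [MeasurableSpace V]

lemma map_compProd_prod_eq_compProd_prod (ρ : Measure F) [SFinite ρ] (κ : Kernel F E)
    [IsSFiniteKernel κ] (ν : Measure G) [SFinite ν] {f : F × G → V} (hf : Measurable f) :
    ((ρ ⊗ₘ κ).prod ν).map (fun q => (q.1.1, f (q.1.1, q.2), q.1.2)) =
      ρ ⊗ₘ ((Kernel.id ×ₖ Kernel.const F ν).map f ×ₖ κ) := by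
  refine Measure.ext_of_lintegral _ fun g hg => ?_
  have hgf : Measurable fun q : (F × E) × G => g (q.1.1, f (q.1.1, q.2), q.1.2) := by fun_prop
  rw [lintegral_map hg (by fun_prop), lintegral_prod _ hgf.aemeasurable,
    Measure.lintegral_compProd hgf.lintegral_prod_right', Measure.lintegral_compProd hg]
  refine lintegral_congr fun h => ?_
  have hgh : Measurable fun z => g (h, z) := hg.comp measurable_prodMk_left
  rw [Kernel.prod_apply, lintegral_prod_symm _ hgh.aemeasurable]
  refine lintegral_congr fun x => ?_
  have hgx : Measurable fun v => g (h, v, x) := hgh.comp measurable_prodMk_right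
  rw [Kernel.lintegral_map _ hf _ hgx, Kernel.prod_apply, Kernel.id_apply, Kernel.const_apply,
    Measure.dirac_prod, lintegral_map (by fun_prop) measurable_prodMk_left]

variable [StandardBorelSpace E] [Nonempty E] [StandardBorelSpace V] [Nonempty V]
  {μ : Measure Ω} [IsProbabilityMeasure μ] {X : Ω → E} {H : Ω → F} {U : Ω → G}

lemma condDistrib_prodMk_of_indepFun (hX : Measurable X) (hH : Measurable H) (hU : Measurable U)
    (hind : IndepFun (fun ω => (H ω, X ω)) U μ) {f : F × G → V} (hf : Measurable f) :
    condDistrib (fun ω => (f (H ω, U ω), X ω)) H μ =ᵐ[μ.map H]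
      ((Kernel.id ×ₖ Kernel.const F (μ.map U)).map f) ×ₖ condDistrib X H μ := by
  have := Measure.isProbabilityMeasure_map (μ := μ) hU.aemeasurable
  have := Kernel.IsMarkovKernel.map (Kernel.id ×ₖ Kernel.const F (μ.map U)) hf
  have hV : Measurable fun ω => f (H ω, U ω) := hf.comp (hH.prodMk hU)
  refine condDistrib_ae_eq_of_measure_eq_compProd H (hV.prodMk hX).aemeasurable ?_
  rw [← map_compProd_prod_eq_compProd_prod _ _ _ hf, compProd_map_condDistrib hX.aemeasurable,
    ← (indepFun_iff_map_prod_eq_prod_map_map (hH.prodMk hX).aemeasurable hU.aemeasurable).mp hind,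
    Measure.map_map (by fun_prop) ((hH.prodMk hX).prodMk hU)]
  rfl

lemma ae_indepFun_condDistrib_of_measurable_sup {W : Ω → V} (hX : Measurable X) (hH : Measurable H)
    (hU : Measurable U) (hind : IndepFun (fun ω => (H ω, X ω)) U μ)
    (hW : Measurable[MeasurableSpace.comap H inferInstance ⊔
      MeasurableSpace.comap U inferInstance] W) :
    ∀ᵐ ω ∂μ, IndepFun Prod.fst Prod.snd (condDistrib (fun ω => (W ω, X ω)) H μ (H ω)) := by
  obtain ⟨f, hf, rfl⟩ : ∃ f : F × G → V, Measurable f ∧ W = f ∘ fun ω => (H ω, U ω) := by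
    rw [← MeasurableSpace.comap_prodMk] at hW
    exact hW.exists_eq_measurable_comp
  have := Measure.isProbabilityMeasure_map (μ := μ) hU.aemeasurable
  have := Kernel.IsMarkovKernel.map (Kernel.id ×ₖ Kernel.const F (μ.map U)) hf
  filter_upwards [ae_of_ae_map hH.aemeasurable
    (condDistrib_prodMk_of_indepFun hX hH hU hind hf)] with ω hω
  simp only [Function.comp_apply, hω, Kernel.prod_apply]
  exact indepFun_prod measurable_id measurable_id

end ConditionalIndependence

lemma measurable_banditHistory {Ω A 𝒴 𝒰 : Type*} [Countable A] [MeasurableSpace A]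
    [DiscreteMeasurableSpace A] [MeasurableSpace 𝒴] [MeasurableSpace 𝒰] {m : MeasurableSpace Ω}
    {act : ℕ → Ω → A} {Y : ℕ → A → Ω → 𝒴} {U : ℕ → Ω → 𝒰}
    (hact : ∀ s, Measurable[MeasurableSpace.comap (banditHistory act Y s) inferInstance ⊔
      MeasurableSpace.comap (U s) inferInstance] (act s)) {n : ℕ}
    (hU : ∀ s < n, Measurable (U s)) (hY : ∀ s < n, ∀ a, Measurable (Y s a)) :
    Measurable (banditHistory act Y n) := by
  induction n using Nat.strong_induction_on with
  | _ n ih =>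
    refine measurable_pi_lambda _ fun s => ?_
    have hhist : Measurable (banditHistory act Y s) :=
      ih s s.2 (fun r hr => hU r (hr.trans s.2)) (fun r hr => hY r (hr.trans s.2))
    have hact_s : Measurable (act s) :=
      (hact s).mono (sup_le hhist.comap_le (hU s s.2).comap_le) le_rfl
    have heval : Measurable fun q : A × (A → 𝒴) => q.2 q.1 :=
      measurable_from_prod_countable_right fun a => measurable_pi_apply a
    exact hact_s.prodMk (heval.comp (hact_s.prodMk (measurable_pi_lambda _ (hY s s.2))))

namespace BanditModel

section History

variable {Ω : Type*} [MeasurableSpace Ω] {μ : Measure Ω} {A 𝒴 𝒰 : Type*} [MeasurableSpace A]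
  [MeasurableSpace 𝒴] [MeasurableSpace 𝒰] (M : BanditModel μ A 𝒴 𝒰) (t : ℕ)

/-- The outcome vector `Y_t = (Y_{t,a})_a`. -/
def outcome (ω : Ω) : A → 𝒴 := fun a => M.Y t a ω

/-- The outcome vectors `(Y_s)_{s < t}` of the periods before `t`. -/
def pastOutcomes (ω : Ω) : Fin t → A → 𝒴 := fun s => M.outcome s ω

/-- The random seeds `(U_s)_{s < t}` of the periods before `t`. -/
def seeds (ω : Ω) : Fin t → 𝒰 := fun s => M.U s ω

lemma measurable_outcome : Measurable (M.outcome t) :=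
  measurable_pi_lambda _ (M.measurable_Y t)

lemma measurable_pastOutcomes : Measurable (M.pastOutcomes t) :=
  measurable_pi_lambda _ fun s => M.measurable_outcome s

lemma measurable_seeds : Measurable (M.seeds t) :=
  measurable_pi_lambda _ fun s => M.measurable_U s

lemma measurable_optimalAction : Measurable M.Astar :=
  M.measurable_Astar.mono M.measurable_pstar.comap_le le_rfl

lemma exists_optimalAction_eq_comp [Countable A] [Nonempty A] [DiscreteMeasurableSpace A] :
    ∃ α : Measure (A → 𝒴) → A, Measurable α ∧ M.Astar = α ∘ M.pstar :=
  M.measurable_Astar.exists_eq_measurable_comp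

variable [Countable A] [DiscreteMeasurableSpace A]

lemma measurable_hist : Measurable (M.hist t) :=
  measurable_banditHistory M.measurable_act (fun s _ => M.measurable_U s)
    fun s _ a => M.measurable_Y s a

lemma measurable_action : Measurable (M.act t) :=
  (M.measurable_act t).mono
    (sup_le (M.measurable_hist t).comap_le (M.measurable_U t).comap_le) le_rfl

variable [Nonempty A] [StandardBorelSpace 𝒴] [Nonempty 𝒴]

lemma exists_hist_eq_comp : ∃ F : (Fin t → 𝒰) × (Fin t → A → 𝒴) → Fin t → A × 𝒴,
    Measurable F ∧ M.hist t = F ∘ fun ω => (M.seeds t ω, M.pastOutcomes t ω) := by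
  have hm : Measurable[MeasurableSpace.comap (fun ω => (M.seeds t ω, M.pastOutcomes t ω))
      inferInstance] fun ω => (M.seeds t ω, M.pastOutcomes t ω) := comap_measurable _
  refine Measurable.exists_eq_measurable_comp (measurable_banditHistory M.measurable_act
    (fun s hs => ?_) fun s hs a => ?_)
  · exact (measurable_pi_apply (⟨s, hs⟩ : Fin t)).comp (measurable_fst.comp hm)
  · exact (measurable_pi_apply a).comp
      ((measurable_pi_apply (⟨s, hs⟩ : Fin t)).comp (measurable_snd.comp hm))

lemma indepFun_hist_seed :
    IndepFun (fun ω => (M.hist t ω, M.Astar ω, M.outcome t ω)) (M.U t) μ := by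
  obtain ⟨F, hF, hhist⟩ := M.exists_hist_eq_comp t
  obtain ⟨α, hα, hopt⟩ := M.exists_optimalAction_eq_comp
  have hG : Measurable fun q : ({s : ℕ // s ≠ t} → 𝒰) × (ℕ → A → 𝒴) × Measure (A → 𝒴) =>
      (F (fun s => q.1 ⟨s, s.2.ne⟩, fun s => q.2.1 s), α q.2.2, q.2.1 t) := by fun_prop
  rw [hhist, hopt]
  exact ((M.indep_U t).comp measurable_id hG).symm

end History

end BanditModel

lemma indepFun_comp_of_indepFun_map {Ω Ω' E F : Type*} [MeasurableSpace Ω] [MeasurableSpace Ω']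
    [MeasurableSpace E] [MeasurableSpace F] {P : Measure Ω} {g : Ω → Ω'} {X : Ω' → E} {Y : Ω' → F}
    (hg : Measurable g) (hX : Measurable X) (hY : Measurable Y) (h : IndepFun X Y (P.map g)) :
    IndepFun (X ∘ g) (Y ∘ g) P := by
  rw [indepFun_iff_measure_inter_preimage_eq_mul] at h ⊢
  intro s t hs ht
  have hst := h s t hs ht
  rw [Measure.map_apply hg ((hX hs).inter (hY ht)), Measure.map_apply hg (hX hs),
    Measure.map_apply hg (hY ht)] at hst
  exact hst

namespace BanditModel

section Posterior

variable {Ω : Type*} [MeasurableSpace Ω] {μ : Measure Ω} {A 𝒴 𝒰 : Type*}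
  [MeasurableSpace A] [DiscreteMeasurableSpace A] [MeasurableSpace 𝒴] [MeasurableSpace 𝒰]
  (M : BanditModel μ A 𝒴 𝒰) (t : ℕ)

section CondLaw

variable [Countable A] {E F : Type*} [MeasurableSpace E]

/-- The triple `(A*, A_t, L)`. For `L = Y_t` its conditional law given `F_t` is `M.posterior t`; it
is also used for latent variables `L` that determine `Y_t`. -/
def triple (L : Ω → E) (ω : Ω) : A × A × E := (M.Astar ω, M.act t ω, L ω)

lemma measurable_triple {L : Ω → E} (hL : Measurable L) : Measurable (M.triple t L) :=
  M.measurable_optimalAction.prodMk ((M.measurable_action t).prodMk hL)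

variable [IsFiniteMeasure μ] [StandardBorelSpace E] [Nonempty E]

instance (X : Ω → E) (ω : Ω) : IsProbabilityMeasure (M.condLaw t X ω) := by
  unfold condLaw
  infer_instance

lemma condLaw_comp [MeasurableSpace F] [StandardBorelSpace F] [Nonempty F] {X : Ω → E}
    (hX : Measurable X) {f : E → F} (hf : Measurable f) :
    ∀ᵐ ω ∂μ, M.condLaw t (f ∘ X) ω = (M.condLaw t X ω).map f := by
  filter_upwards [ae_of_ae_map (M.measurable_hist t).aemeasurable
    (condDistrib_comp (μ := μ) (M.hist t) hX.aemeasurable hf)] with ω hω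
  rw [condLaw, condLaw, ← Kernel.map_apply _ hf, ← hω]

lemma ae_hasSubgaussianMGF_condLaw {X : Ω → E} (hX : Measurable X) {f : E → ℝ} (hf : Measurable f)
    {σ : Ω → ℝ} (h : M.CenteredSubGaussian t (f ∘ X) σ) :
    ∀ᵐ ω ∂μ, HasSubgaussianMGF (fun x => f x - ∫ y, f y ∂(M.condLaw t X ω))
      (σ ω ^ 2).toNNReal (M.condLaw t X ω) := by
  filter_upwards [ae_all_iff.mpr fun q : ℚ => h q, M.condLaw_comp t hX hf] with ω hrat hmap
  have hmean : ∫ z, z ∂(M.condLaw t (f ∘ X) ω) = ∫ y, f y ∂(M.condLaw t X ω) := by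
    rw [hmap, integral_map (f := fun z => z) hf.aemeasurable (by fun_prop)]
  refine hasSubgaussianMGF_of_forall_rat fun q => ?_
  have hq := hrat q
  rw [hmean, hmap, integrable_map_measure (by fun_prop) hf.aemeasurable,
    integral_map hf.aemeasurable (by fun_prop)] at hq
  refine ⟨hq.1, hq.2.trans_eq ?_⟩
  rw [mul_comm ((q : ℝ) ^ 2), Real.coe_toNNReal _ (sq_nonneg _)]

end CondLaw

variable [Fintype A] [Nonempty A] [StandardBorelSpace 𝒴] [Nonempty 𝒴]

instance [IsFiniteMeasure μ] (ω : Ω) : IsProbabilityMeasure (M.posterior t ω) :=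
  inferInstanceAs (IsProbabilityMeasure (M.condLaw t _ ω))

variable [IsProbabilityMeasure μ]

lemma ae_indepFun_posterior : ∀ᵐ ω ∂μ, IndepFun (fun w : A × A × (A → 𝒴) => w.2.1)
    (fun w => (w.1, w.2.2)) (M.posterior t ω) := by
  have hVX := M.measurable_optimalAction.prodMk (M.measurable_outcome t)
  have hcond := ae_indepFun_condDistrib_of_measurable_sup hVX (M.measurable_hist t)
    (M.measurable_U t) (M.indepFun_hist_seed t) (M.measurable_act t)
  have hperm : Measurable fun w : A × A × (A → 𝒴) => (w.2.1, w.1, w.2.2) := by fun_prop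
  filter_upwards [hcond, M.condLaw_comp t (M.measurable_triple t (M.measurable_outcome t)) hperm]
    with ω hind hmap
  refine indepFun_comp_of_indepFun_map hperm measurable_fst measurable_snd ?_
  rw [← show M.condLaw t _ ω = (M.posterior t ω).map _ from hmap]
  exact hind

lemma ae_isProbabilityMatching_posterior (hTS : M.IsThompsonSampling) :
    ∀ᵐ ω ∂μ, IsProbabilityMatching (M.posterior t ω) (fun w => w.1) (fun w => w.2.1)
      fun a w => w.2.2 a := by
  filter_upwards [M.ae_indepFun_posterior t, ae_all_iff.mpr (hTS t)] with ω hind hmatch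
  exact ⟨by fun_prop, by fun_prop, by fun_prop, hind, hmatch⟩

end Posterior

end BanditModel

lemma mutualInfo_map {Ω Ω' E F : Type*} [MeasurableSpace Ω] [MeasurableSpace Ω']
    [MeasurableSpace E] [MeasurableSpace F] {P : Measure Ω} {g : Ω → Ω'} {X : Ω' → E} {Y : Ω' → F}
    (hg : Measurable g) (hX : Measurable X) (hY : Measurable Y) :
    mutualInfo (P.map g) X Y = mutualInfo P (X ∘ g) (Y ∘ g) := by
  rw [mutualInfo, Measure.map_map (hX.prodMk hY) hg, Measure.map_map hX hg, Measure.map_map hY hg]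
  rfl

lemma IsProbabilityMatching.of_map {W W' A 𝒴 : Type*} [MeasurableSpace W] [MeasurableSpace W']
    [MeasurableSpace A] [MeasurableSingletonClass A] [MeasurableSpace 𝒴]
    {P : Measure W} {g : W → W'} (hg : Measurable g) {opt act : W' → A} {Y : A → W' → 𝒴}
    (h : IsProbabilityMatching (P.map g) opt act Y) :
    IsProbabilityMatching P (opt ∘ g) (act ∘ g) fun a => Y a ∘ g where
  measurable_opt := h.measurable_opt.comp hg
  measurable_act := h.measurable_act.comp hg
  measurable_outcome a := (h.measurable_outcome a).comp hg
  indepFun := indepFun_comp_of_indepFun_map hg h.measurable_act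
    (h.measurable_opt.prodMk (measurable_pi_lambda _ h.measurable_outcome)) h.indepFun
  measure_eq a := by
    have ha := h.measure_eq a
    rwa [Measure.map_apply hg (h.measurable_act (measurableSet_singleton a)),
      Measure.map_apply hg (h.measurable_opt (measurableSet_singleton a))] at ha

namespace BanditModel

section InformationRatio

variable {Ω : Type*} [MeasurableSpace Ω] {μ : Measure Ω} [IsProbabilityMeasure μ] {A 𝒴 𝒰 : Type*}
  [Fintype A] [Nonempty A] [MeasurableSpace A] [DiscreteMeasurableSpace A] [MeasurableSpace 𝒴]
  [StandardBorelSpace 𝒴] [Nonempty 𝒴] [MeasurableSpace 𝒰] (M : BanditModel μ A 𝒴 𝒰) (t : ℕ)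

lemma infoRatioLE_of_posterior_eq_map {W : Type*} [MeasurableSpace W] {P : Measure W}
    [IsProbabilityMeasure P] {opt act : W → A} {Y : A → W → 𝒴}
    (h : IsProbabilityMatching P opt act Y) {ω : Ω}
    (hpost : M.posterior t ω = P.map fun w => (opt w, act w, fun a => Y a w))
    (hint : ∀ a, Integrable (fun w => M.R (Y a w)) P) {c : ℝ}
    (hsq : (∑ a, ∫ w in opt ⁻¹' {a}, (M.R (Y a w) - ∫ z, M.R (Y a z) ∂P) ∂P) ^ 2 ≤
      c * (mutualInfo P opt fun w => (act w, Y (act w) w)).toReal) :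
    M.InfoRatioLE t c ω := by
  have hg : Measurable fun w => (opt w, act w, fun a => Y a w) := h.measurable_opt.prodMk
    (h.measurable_act.prodMk (measurable_pi_lambda _ h.measurable_outcome))
  have heval : Measurable fun q : A × (A → 𝒴) => q.2 q.1 :=
    measurable_from_prod_countable_right fun a => measurable_pi_apply a
  have hobs : Measurable fun w : A × A × (A → 𝒴) => (w.2.1, w.2.2 w.2.1) :=
    (measurable_fst.comp measurable_snd).prodMk (heval.comp measurable_snd)
  have hregret : Measurable M.regretVar :=
    (M.measurable_R.comp (heval.comp (by fun_prop : Measurable fun w => (w.1, w.2.2)))).sub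
      (M.measurable_R.comp (heval.comp measurable_snd))
  have hfin : M.infoGain t ω ≠ ∞ := mutualInfo_ne_top measurable_fst hobs
  have hgain : M.infoGain t ω = mutualInfo P opt fun w => (act w, Y (act w) w) := by
    rw [infoGain, hpost, mutualInfo_map hg measurable_fst hobs]
    rfl
  refine ⟨?_, hfin, ENNReal.div_le_of_le_mul ?_⟩
  · rw [hpost, integrable_map_measure hregret.aestronglyMeasurable hg.aemeasurable]
    exact (integrable_apply_of_finite h.measurable_opt hint).sub
      (integrable_apply_of_finite h.measurable_act hint)
  · rw [← ENNReal.ofReal_toReal hfin, ← ENNReal.ofReal_mul' ENNReal.toReal_nonneg, hgain, hpost,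
      integral_map hg.aemeasurable hregret.aestronglyMeasurable]
    refine ENNReal.ofReal_le_ofReal (le_of_eq_of_le (congrArg (· ^ 2) ?_) hsq)
    exact h.integral_regret (X := fun a w => M.R (Y a w))
      (fun a => M.measurable_R.comp (comap_measurable _)) hint

lemma ae_infoRatioLE_of_latent (hTS : M.IsThompsonSampling) {E : Type*} [MeasurableSpace E]
    [StandardBorelSpace E] [Nonempty E] {L : Ω → E} (hL : Measurable L) {obs : A → E → 𝒴}
    (hobs : ∀ a, Measurable (obs a)) (hY : ∀ a ω, M.Y t a ω = obs a (L ω)) {c : ℝ}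
    (hint : ∀ a, ∀ᵐ ω ∂μ,
      Integrable (fun w => M.R (obs a w.2.2)) (M.condLaw t (M.triple t L) ω))
    (hsq : ∀ᵐ ω ∂μ, let P := M.condLaw t (M.triple t L) ω
      IsProbabilityMatching P Prod.fst (fun w => w.2.1) (fun a w => obs a w.2.2) →
      (∑ a, ∫ w in Prod.fst ⁻¹' {a}, (M.R (obs a w.2.2) - ∫ z, M.R (obs a z.2.2) ∂P) ∂P) ^ 2 ≤
        c * (mutualInfo P Prod.fst fun w => (w.2.1, obs w.2.1 w.2.2)).toReal) :
    ∀ᵐ ω ∂μ, M.InfoRatioLE t c ω := by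
  have hg : Measurable fun w : A × A × E => (w.1, w.2.1, fun a => obs a w.2.2) := by fun_prop
  have htriple : M.triple t (M.outcome t) =
      (fun w => (w.1, w.2.1, fun a => obs a w.2.2)) ∘ M.triple t L :=
    funext fun ω => congrArg (fun y => (M.Astar ω, M.act t ω, y)) (funext fun a => hY a ω)
  filter_upwards [M.condLaw_comp t (M.measurable_triple t hL) hg,
    M.ae_isProbabilityMatching_posterior t hTS, ae_all_iff.mpr hint, hsq] with ω hmap hmatch hi hs
  have hpost : M.posterior t ω =
      (M.condLaw t (M.triple t L) ω).map fun w => (w.1, w.2.1, fun a => obs a w.2.2) := by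
    rw [← hmap, ← htriple]
    rfl
  have hmatchL := IsProbabilityMatching.of_map hg (hpost ▸ hmatch)
  exact M.infoRatioLE_of_posterior_eq_map t hmatchL hpost hi (hs hmatchL)

end InformationRatio

end BanditModel

lemma integrable_of_hasSubgaussianMGF_sub_const {Ω : Type*} [MeasurableSpace Ω] {P : Measure Ω}
    [IsFiniteMeasure P] {f : Ω → ℝ} {m : ℝ} {c : ℝ≥0}
    (h : HasSubgaussianMGF (fun x => f x - m) c P) : Integrable f P := by
  simpa only [Pi.add_def, sub_add_cancel] using h.integrable.add (integrable_const m)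

lemma standardBorelSpace_of_measurableEmbedding {E F : Type*} [MeasurableSpace E]
    [MeasurableSpace F] [StandardBorelSpace F] {e : E → F} (he : MeasurableEmbedding e) :
    StandardBorelSpace E := by
  have := he.measurableSet_range.standardBorel
  obtain ⟨τ, _, _⟩ := this.polish
  let _ : TopologicalSpace E := τ.induced he.equivRange
  have : BorelSpace E := ⟨by
    rw [borel_comap, ← BorelSpace.measurable_eq, he.equivRange.measurableEmbedding.comap_eq]⟩
  have : PolishSpace E := he.equivRange.toEquiv.polishSpace_induced
  infer_instance

lemma iIndepFun_comp_of_iIndepFun_map {Ω Ω' ι : Type*} {E : ι → Type*} [MeasurableSpace Ω]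
    [MeasurableSpace Ω'] [∀ i, MeasurableSpace (E i)] {P : Measure Ω} {g : Ω → Ω'}
    {X : ∀ i, Ω' → E i} (hg : Measurable g) (hX : ∀ i, Measurable (X i))
    (h : iIndepFun X (P.map g)) : iIndepFun (fun i => X i ∘ g) P := by
  rw [iIndepFun_iff_measure_inter_preimage_eq_mul] at h ⊢
  intro S B hB
  have hSB := h S hB
  rw [Measure.map_apply hg (S.measurableSet_biInter fun i hi => hX i (hB i hi))] at hSB
  simp only [preimage_iInter] at hSB
  refine hSB.trans (Finset.prod_congr rfl fun i hi => Measure.map_apply hg (hX i (hB i hi)))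

lemma measurable_comap_of_measurableEmbedding {W E F G : Type*} [MeasurableSpace E]
    [MeasurableSpace F] [MeasurableSpace G] {e : E → F} (he : MeasurableEmbedding e) {g : W → E}
    {f : E → G} (hf : Measurable f) :
    Measurable[MeasurableSpace.comap (fun w => e (g w)) inferInstance] fun w => f (g w) := by
  have hcomap : MeasurableSpace.comap (fun w => e (g w)) inferInstance =
      MeasurableSpace.comap g inferInstance := by
    rw [← he.comap_eq, MeasurableSpace.comap_comp]
    rfl
  rw [hcomap]
  exact hf.comp (comap_measurable g)

namespace BanditModel

lemma IsSemiBandit.ae_iIndepFun_triple {Ω : Type*} [MeasurableSpace Ω] {μ : Measure Ω}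
    [IsFiniteMeasure μ] {A 𝒴 𝒰 : Type*} [Countable A] [Nonempty A] [MeasurableSpace A]
    [DiscreteMeasurableSpace A] [MeasurableSpace 𝒴] [MeasurableSpace 𝒰] {M : BanditModel μ A 𝒴 𝒰}
    {t d m : ℕ} {S : A → Finset (Fin d)} {θ : Fin d → Ω → ℝ} {enc : (a : A) → (S a → ℝ) → 𝒴}
    (hS : M.IsSemiBandit t m S θ enc) :
    ∀ᵐ ω ∂μ, iIndepFun (fun i (w : A × A × (Fin d → ℝ)) => w.2.2 i)
      (M.condLaw t (M.triple t fun ω' i => θ i ω') ω) := by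
  have hθ : Measurable fun ω i => θ i ω := measurable_pi_lambda _ hS.measurable_θ
  filter_upwards [hS.cond_indep, M.condLaw_comp t (M.measurable_triple t hθ)
    (f := fun w => w.2.2) (by fun_prop)] with ω hω hmap
  exact iIndepFun_comp_of_iIndepFun_map (by fun_prop) (fun i => measurable_pi_apply i)
    (by rwa [← hmap])

section Applications

variable {Ω : Type*} [MeasurableSpace Ω] {μ : Measure Ω} [IsProbabilityMeasure μ] {A 𝒴 𝒰 : Type*}
  [Fintype A] [Nonempty A] [MeasurableSpace A] [DiscreteMeasurableSpace A] [MeasurableSpace 𝒴]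
  [StandardBorelSpace 𝒴] [Nonempty 𝒴] [MeasurableSpace 𝒰] (M : BanditModel μ A 𝒴 𝒰) (t : ℕ)

lemma ae_hasSubgaussianMGF_posterior {σ : Ω → ℝ}
    (hsub : ∀ a, M.CenteredSubGaussian t (M.reward t a) σ) :
    ∀ᵐ ω ∂μ, ∀ a, HasSubgaussianMGF
      (fun w => M.R (w.2.2 a) - ∫ z, M.R (z.2.2 a) ∂(M.posterior t ω)) (σ ω ^ 2).toNNReal
      (M.posterior t ω) :=
  ae_all_iff.mpr fun a => M.ae_hasSubgaussianMGF_condLaw t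
    (M.measurable_triple t (M.measurable_outcome t)) (f := fun w => M.R (w.2.2 a))
    (M.measurable_R.comp (by fun_prop)) (hsub a)

variable {t} in
lemma ae_infoRatioLE_of_sq_sum_setIntegral_le (hTS : M.IsThompsonSampling) {σ c : ℝ}
    (hsub : ∀ a, M.CenteredSubGaussian t (M.reward t a) fun _ => σ)
    (hsq : ∀ᵐ ω ∂μ, let P := M.posterior t ω
      (∀ a, HasSubgaussianMGF (fun w => M.R (w.2.2 a) - ∫ z, M.R (z.2.2 a) ∂P)
        (σ ^ 2).toNNReal P) →
      IsProbabilityMatching P Prod.fst (fun w => w.2.1) (fun a w => w.2.2 a) →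
      (∑ a, ∫ w in Prod.fst ⁻¹' {a}, (M.R (w.2.2 a) - ∫ z, M.R (z.2.2 a) ∂P) ∂P) ^ 2 ≤
        c * (mutualInfo P Prod.fst fun w => (w.2.1, w.2.2 w.2.1)).toReal) :
    ∀ᵐ ω ∂μ, M.InfoRatioLE t c ω := by
  have hpost := M.ae_hasSubgaussianMGF_posterior t hsub
  refine M.ae_infoRatioLE_of_latent t hTS (M.measurable_outcome t) (obs := fun a y => y a)
    (fun a => measurable_pi_apply a) (fun _ _ => rfl) (fun a => ?_) ?_
  · filter_upwards [hpost] with ω hω using integrable_of_hasSubgaussianMGF_sub_const (hω a)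
  · filter_upwards [hpost, hsq] with ω hω hs using hs hω

theorem ae_infoRatioLE_card (hTS : M.IsThompsonSampling) {σ : ℝ}
    (hsub : ∀ a, M.CenteredSubGaussian t (M.reward t a) fun _ => σ) :
    ∀ᵐ ω ∂μ, M.InfoRatioLE t (2 * Fintype.card A * σ ^ 2) ω := by
  refine M.ae_infoRatioLE_of_sq_sum_setIntegral_le hTS hsub (.of_forall fun ω hω hmatch => ?_)
  have hsq := hmatch.sq_sum_setIntegral_le_card
    (fun a => (M.measurable_R.comp (comap_measurable _)).sub_const _) hω
  rwa [Real.coe_toNNReal _ (sq_nonneg σ)] at hsq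

theorem ae_infoRatioLE_of_isFullInformation (hTS : M.IsThompsonSampling) {σ : ℝ}
    (hsub : ∀ a, M.CenteredSubGaussian t (M.reward t a) fun _ => σ) {𝒵 : Type*}
    [MeasurableSpace 𝒵] {Z : Ω → 𝒵} {enc : A → 𝒵 → 𝒴} (hF : M.IsFullInformation t Z enc) :
    ∀ᵐ ω ∂μ, M.InfoRatioLE t (2 * σ ^ 2) ω := by
  have := standardBorelSpace_of_measurableEmbedding (hF.enc_embedding (Classical.arbitrary A))
  have : Nonempty 𝒵 := (nonempty_of_isProbabilityMeasure μ).map Z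
  have hR : ∀ a, Measurable fun w : A × A × 𝒵 => M.R (enc a w.2.2) := fun a =>
    M.measurable_R.comp ((hF.enc_embedding a).measurable.comp (by fun_prop))
  have hreward : ∀ a, M.reward t a = (fun w => M.R (enc a w.2.2)) ∘ M.triple t Z := fun a =>
    funext fun ω => congrArg M.R (hF.outcome_eq a ω)
  have hlatent : ∀ᵐ ω ∂μ, ∀ a, HasSubgaussianMGF (fun w => M.R (enc a w.2.2) -
      ∫ z, M.R (enc a z.2.2) ∂(M.condLaw t (M.triple t Z) ω)) (σ ^ 2).toNNReal
      (M.condLaw t (M.triple t Z) ω) := ae_all_iff.mpr fun a =>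
    M.ae_hasSubgaussianMGF_condLaw t (M.measurable_triple t hF.measurable_Z) (hR a)
      (hreward a ▸ hsub a)
  refine M.ae_infoRatioLE_of_latent t hTS hF.measurable_Z
    (fun a => (hF.enc_embedding a).measurable) hF.outcome_eq (fun a => ?_) ?_
  · filter_upwards [hlatent] with ω hω using integrable_of_hasSubgaussianMGF_sub_const (hω a)
  · filter_upwards [hlatent] with ω hω P hmatch
    have hsq := hmatch.sq_sum_setIntegral_le_of_measurable_comap (fun b a =>
      (measurable_comap_of_measurableEmbedding (hF.enc_embedding a)
        (M.measurable_R.comp (hF.enc_embedding b).measurable)).sub_const _) hω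
    rwa [Real.coe_toNNReal _ (sq_nonneg σ)] at hsq

theorem ae_infoRatioLE_of_isSemiBandit (hTS : M.IsThompsonSampling) {σ : ℝ} {d m : ℕ}
    {S : A → Finset (Fin d)} {θ : Fin d → Ω → ℝ} {enc : (a : A) → (S a → ℝ) → 𝒴}
    (hS : M.IsSemiBandit t m S θ enc) (hsub : ∀ i, M.CenteredSubGaussian t (θ i) fun _ => σ) :
    ∀ᵐ ω ∂μ, M.InfoRatioLE t (2 * d * σ ^ 2 / m ^ 2) ω := by
  have hθ : Measurable fun ω i => θ i ω := measurable_pi_lambda _ hS.measurable_θ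
  have hlatent : ∀ᵐ ω ∂μ, ∀ i, HasSubgaussianMGF
      (fun w => w.2.2 i - ∫ z, z.2.2 i ∂(M.condLaw t (M.triple t fun ω i => θ i ω) ω))
      (σ ^ 2).toNNReal (M.condLaw t (M.triple t fun ω i => θ i ω) ω) := ae_all_iff.mpr fun i =>
    M.ae_hasSubgaussianMGF_condLaw t (M.measurable_triple t hθ) (f := fun w => w.2.2 i)
      (by fun_prop) (hsub i)
  refine M.ae_infoRatioLE_of_latent t hTS hθ (obs := fun a x => enc a fun i => x i)
    (fun a => (hS.enc_measurable a).comp (by fun_prop)) hS.outcome_eq (fun a => ?_) ?_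
  · filter_upwards [hlatent] with ω hω
    simp only [hS.reward_eq]
    exact (integrable_finsetSum Finset.univ fun i _ =>
      integrable_of_hasSubgaussianMGF_sub_const (hω _)).const_mul _
  · filter_upwards [hlatent, hS.ae_iIndepFun_triple] with ω hω hi P hmatch
    have hsq := hmatch.sq_sum_setIntegral_le_items (S := S)
      (θ := fun i w => w.2.2 i - ∫ z, z.2.2 i ∂P) (fun a i hia =>
        (measurable_comap_of_measurableEmbedding
          ((hS.enc_measurable a).measurableEmbedding (hS.enc_injective a))
          (measurable_pi_apply (⟨i, hia⟩ : S a))).sub_const _)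
      (hi.comp (fun i x => x - ∫ z, z.2.2 i ∂P) fun i => measurable_id.sub_const _) hω
    have hcentered : ∀ a (w : A × A × (Fin d → ℝ)), M.R (enc a fun i => w.2.2 i) -
        ∫ z, M.R (enc a fun i => z.2.2 i) ∂P = 1 / m * ∑ i ∈ S a, (w.2.2 i - ∫ z, z.2.2 i ∂P) := by
      intro a w
      simp_rw [hS.reward_eq]
      rw [integral_const_mul, integral_finsetSum Finset.univ fun (i : S a) _ =>
        integrable_of_hasSubgaussianMGF_sub_const (hω i), Finset.sum_sub_distrib,
        Finset.sum_coe_sort (S a) fun i => w.2.2 i,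
        Finset.sum_coe_sort (S a) fun i => ∫ z, z.2.2 i ∂P, mul_sub]
    rw [Real.coe_toNNReal _ (sq_nonneg σ), Fintype.card_fin] at hsq
    simp_rw [hcentered, integral_const_mul, ← Finset.mul_sum]
    refine (mul_pow _ _ 2).trans_le ((mul_le_mul_of_nonneg_left hsq (sq_nonneg _)).trans_eq ?_)
    ring

end Applications

end BanditModel

section HasLawGiven

variable {Ω E F G : Type*} [MeasurableSpace Ω] [MeasurableSpace E] [MeasurableSpace F]
  [MeasurableSpace G]

/-- `X` has the conditional law `κ` given `V` together with the random measure `κ` itself. Applied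
to the outcome vector `X = Y_t` and `κ = p*`, it expresses that `V` carries no information about
`Y_t` beyond `p*`. -/
def HasLawGiven (X : Ω → E) (κ : Kernel Ω E) (V : Ω → F) (μ : Measure Ω) : Prop :=
  ∀ ⦃C⦄, MeasurableSet C → ∀ ⦃B⦄, MeasurableSet B →
    μ (V ⁻¹' C ∩ X ⁻¹' B) = ∫⁻ ω in V ⁻¹' C, κ ω B ∂μ

variable {X : Ω → E} {κ : Kernel Ω E} {V : Ω → F} {μ : Measure Ω}

lemma HasLawGiven.comp (h : HasLawGiven X κ V μ) {f : F → G} (hf : Measurable f) :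
    HasLawGiven X κ (f ∘ V) μ :=
  fun _ hC _ hB => h (hf hC) hB

lemma HasLawGiven.of_isPiSystem [IsFiniteMeasure μ] (hV : Measurable V)
    {π : Set (Set F)} (hgen : ‹MeasurableSpace F› = .generateFrom π)
    (hπ : IsPiSystem π) (huniv : univ ∈ π)
    (h : ∀ C ∈ π, ∀ ⦃B⦄, MeasurableSet B →
      μ (V ⁻¹' C ∩ X ⁻¹' B) = ∫⁻ ω in V ⁻¹' C, κ ω B ∂μ) :
    HasLawGiven X κ V μ := by
  intro C hC B hB
  have hleft {C : Set F} (hC : MeasurableSet C) :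
      (μ.restrict (X ⁻¹' B)).map V C = μ (V ⁻¹' C ∩ X ⁻¹' B) := by
    rw [Measure.map_apply hV hC, Measure.restrict_apply (hV hC)]
  have hright {C : Set F} (hC : MeasurableSet C) :
      (μ.withDensity fun ω => κ ω B).map V C = ∫⁻ ω in V ⁻¹' C, κ ω B ∂μ := by
    rw [Measure.map_apply hV hC, withDensity_apply _ (hV hC)]
  have hagree : ∀ C ∈ π, (μ.restrict (X ⁻¹' B)).map V C =
      (μ.withDensity fun ω => κ ω B).map V C := fun C hC => by
    have hCm : MeasurableSet C := hgen ▸ MeasurableSpace.measurableSet_generateFrom hC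
    rw [hleft hCm, hright hCm, h C hC hB]
  rw [← hleft hC, ← hright hC,
    ext_of_generate_finite π hgen hπ hagree (hagree univ huniv)]

lemma HasLawGiven.prodMk_of_indepFun [IsFiniteMeasure μ]
    (h : HasLawGiven X κ V μ) (hX : Measurable X) (hV : Measurable V) {S : Ω → G}
    (hS : Measurable S) (hind : IndepFun S (fun ω => (V ω, X ω, κ ω)) μ) :
    HasLawGiven X κ (fun ω => (S ω, V ω)) μ := by
  refine .of_isPiSystem (hS.prodMk hV) generateFrom_prod.symm isPiSystem_prod
    ⟨univ, .univ, univ, .univ, univ_prod_univ⟩ ?_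
  rintro _ ⟨C, hC, D, hD, rfl⟩ B hB
  have hpre : (fun ω => (S ω, V ω)) ⁻¹' C ×ˢ D = S ⁻¹' C ∩ V ⁻¹' D := rfl
  have hκB : Measurable fun q : F × E × Measure E => D.indicator (fun _ => q.2.2 B) q.1 := by
    have hBm : Measurable fun q : F × E × Measure E => q.2.2 B :=
      (Measure.measurable_coe hB).comp (measurable_snd.comp measurable_snd)
    exact hBm.indicator (measurable_fst hD)
  have hC1 : Measurable (C.indicator (1 : G → ℝ≥0∞)) := measurable_one.indicator hC
  rw [hpre]
  calc μ (S ⁻¹' C ∩ V ⁻¹' D ∩ X ⁻¹' B)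
      = μ (S ⁻¹' C) * μ (V ⁻¹' D ∩ X ⁻¹' B) := by
        rw [inter_assoc]
        exact (hind.comp measurable_id (measurable_fst.prodMk
          (measurable_fst.comp measurable_snd))).measure_inter_preimage_eq_mul C (D ×ˢ B) hC
          (hD.prod hB)
    _ = (∫⁻ ω, C.indicator 1 (S ω) ∂μ) * ∫⁻ ω, D.indicator (fun _ => κ ω B) (V ω) ∂μ := by
        rw [h hD hB, ← lintegral_indicator_one (hS hC), ← lintegral_indicator (hV hD)]
        rfl
    _ = ∫⁻ ω, C.indicator 1 (S ω) * D.indicator (fun _ => κ ω B) (V ω) ∂μ :=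
        (lintegral_mul_eq_lintegral_mul_lintegral_of_indepFun''
          (hC1.comp hS).aemeasurable
          (hκB.comp (hV.prodMk (hX.prodMk κ.measurable))).aemeasurable
          (hind.comp hC1 hκB)).symm
    _ = ∫⁻ ω in S ⁻¹' C ∩ V ⁻¹' D, κ ω B ∂μ := by
        rw [← lintegral_indicator ((hS hC).inter (hV hD))]
        refine lintegral_congr fun ω => ?_
        by_cases hSω : S ω ∈ C <;> by_cases hVω : V ω ∈ D <;> simp [hSω, hVω]

lemma HasLawGiven.map_prodMk_eq [IsFiniteMeasure μ] [IsMarkovKernel κ] (h : HasLawGiven X κ V μ)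
    (hX : Measurable X) (hV : Measurable V) :
    μ.map (fun ω => (V ω, X ω)) = (μ ⊗ₘ κ).map (Prod.map V id) := by
  refine Measure.ext_prod fun {C B} hC hB => ?_
  have hpre : (Prod.map V id ⁻¹' C ×ˢ B : Set (Ω × E)) = (V ⁻¹' C) ×ˢ B := rfl
  rw [Measure.map_apply (hV.prodMk hX) (hC.prod hB),
    Measure.map_apply (hV.prodMap measurable_id) (hC.prod hB), hpre,
    Measure.compProd_apply_prod (hV hC) hB]
  exact h hC hB

lemma HasLawGiven.integral_eq [IsFiniteMeasure μ] [IsMarkovKernel κ] (h : HasLawGiven X κ V μ)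
    (hX : Measurable X) (hV : Measurable V) {H : Type*} [NormedAddCommGroup H] [NormedSpace ℝ H]
    {f : F × E → H} (hf : StronglyMeasurable f) (hint : Integrable (fun ω => f (V ω, X ω)) μ) :
    ∫ ω, f (V ω, X ω) ∂μ = ∫ ω, ∫ x, f (V ω, x) ∂(κ ω) ∂μ := by
  have hVX : AEMeasurable (fun ω => (V ω, X ω)) μ := (hV.prodMk hX).aemeasurable
  have hmap : Measurable (Prod.map V id : Ω × E → F × E) := hV.prodMap measurable_id
  have hint' : Integrable (f ∘ Prod.map V id) (μ ⊗ₘ κ) := by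
    rw [← integrable_map_measure hf.aestronglyMeasurable hmap.aemeasurable,
      ← h.map_prodMk_eq hX hV]
    exact (integrable_map_measure hf.aestronglyMeasurable hVX).mpr hint
  rw [← integral_map hVX hf.aestronglyMeasurable, h.map_prodMk_eq hX hV,
    integral_map hmap.aemeasurable hf.aestronglyMeasurable]
  exact Measure.integral_compProd hint'

end HasLawGiven

lemma exists_seq_set_eq_of_fin {E : Type*} [MeasurableSpace E] {t : ℕ} {B : Fin t → Set E}
    (hB : ∀ s, MeasurableSet (B s)) {B₀ : Set E} (hB₀ : MeasurableSet B₀) :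
    ∃ B' : ℕ → Set E, (∀ n, MeasurableSet (B' n)) ∧ (∀ s : Fin t, B' s = B s) ∧ B' t = B₀ := by
  refine ⟨fun n => if h : n < t then B ⟨n, h⟩ else B₀, fun n => ?_, fun s => ?_, ?_⟩
  · by_cases h : n < t <;> simp [h, hB, hB₀]
  · simp
  · simp

namespace BanditModel

section OutcomeLaw

variable {Ω : Type*} [MeasurableSpace Ω] {μ : Measure Ω} {A 𝒴 𝒰 : Type*} [MeasurableSpace A]
  [MeasurableSpace 𝒴] [MeasurableSpace 𝒰] (M : BanditModel μ A 𝒴 𝒰) (t : ℕ)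

/-- The true outcome distribution `p*`, as a Markov kernel. -/
def pstarKernel : Kernel Ω (A → 𝒴) := ⟨M.pstar, M.measurable_pstar⟩

instance : IsMarkovKernel M.pstarKernel := ⟨fun ω => M.family_prob _ (M.pstar_mem ω)⟩

lemma setLIntegral_pstar (s : Finset ℕ) {B : ℕ → Set (A → 𝒴)} (hB : ∀ n, MeasurableSet (B n))
    {g : Measure (A → 𝒴) → ℝ≥0∞} (hg : Measurable g) :
    ∫⁻ ω in ⋂ n ∈ s, M.outcome n ⁻¹' B n, g (M.pstar ω) ∂μ =
      ∫⁻ ω, (∏ n ∈ s, M.pstar ω (B n)) * g (M.pstar ω) ∂μ := by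
  have hp := M.measurable_pstar
  have hgp : Measurable fun ω => g (M.pstar ω) := hg.comp hp
  have hprod : Measurable fun ω => ∏ n ∈ s, M.pstar ω (B n) :=
    Finset.measurable_fun_prod s fun n _ => (Measure.measurable_coe (hB n)).comp hp
  have hmap : (μ.restrict (⋂ n ∈ s, M.outcome n ⁻¹' B n)).map M.pstar =
      (μ.withDensity fun ω => ∏ n ∈ s, M.pstar ω (B n)).map M.pstar := by
    ext C hC
    rw [Measure.map_apply hp hC, Measure.map_apply hp hC, Measure.restrict_apply (hp hC),
      withDensity_apply _ (hp hC)]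
    exact M.cond_iid s B C hB hC
  rw [← lintegral_map hg hp, hmap, lintegral_map hg hp,
    lintegral_withDensity_eq_lintegral_mul _ hprod hgp]
  rfl

lemma hasLawGiven_pastOutcomes_pstar [IsFiniteMeasure μ] :
    HasLawGiven (M.outcome t) M.pstarKernel (fun ω => (M.pastOutcomes t ω, M.pstar ω)) μ := by
  have hp := M.measurable_pstar
  refine .of_isPiSystem ((M.measurable_pastOutcomes t).prodMk hp)
    (generateFrom_eq_prod generateFrom_pi MeasurableSpace.generateFrom_measurableSet
      (.pi fun _ => isCountablySpanning_measurableSet) isCountablySpanning_measurableSet).symm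
    (isPiSystem_pi.prod MeasurableSpace.isPiSystem_measurableSet)
    ⟨univ, ⟨fun _ => univ, by simp, pi_univ _⟩, univ, by simp, univ_prod_univ⟩ ?_
  rintro _ ⟨_, ⟨B, hB, rfl⟩, C, hC, rfl⟩ B₀ hB₀
  obtain ⟨B', hB'm, hB's, hB't⟩ := exists_seq_set_eq_of_fin
    (fun s => show MeasurableSet (B s) from hB s (mem_univ s)) hB₀
  have hpast : (fun ω => (M.pastOutcomes t ω, M.pstar ω)) ⁻¹' (univ.pi B ×ˢ C) =
      M.pstar ⁻¹' C ∩ ⋂ n ∈ Finset.range t, M.outcome n ⁻¹' B' n := by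
    ext ω
    simp [pastOutcomes, ← hB's, Fin.forall_iff, and_comm]
  have hpresent : M.pstar ⁻¹' C ∩ (⋂ n ∈ Finset.range t, M.outcome n ⁻¹' B' n) ∩
      M.outcome t ⁻¹' B₀ = M.pstar ⁻¹' C ∩ ⋂ n ∈ Finset.range (t + 1), M.outcome n ⁻¹' B' n := by
    rw [Finset.range_add_one, Finset.set_biInter_insert, hB't, inter_assoc,
      inter_comm (M.outcome t ⁻¹' B₀)]
  rw [hpast, hpresent]
  calc μ (M.pstar ⁻¹' C ∩ ⋂ n ∈ Finset.range (t + 1), M.outcome n ⁻¹' B' n)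
      = ∫⁻ ω in M.pstar ⁻¹' C, ∏ n ∈ Finset.range (t + 1), M.pstar ω (B' n) ∂μ :=
        M.cond_iid _ B' C hB'm hC
    _ = ∫⁻ ω, (∏ n ∈ Finset.range t, M.pstar ω (B' n)) *
          C.indicator (fun p => p B₀) (M.pstar ω) ∂μ := by
        rw [← lintegral_indicator (hp hC)]
        refine lintegral_congr fun ω => ?_
        by_cases hω : M.pstar ω ∈ C <;> simp [hω, Finset.prod_range_succ, hB't]
    _ = ∫⁻ ω in ⋂ n ∈ Finset.range t, M.outcome n ⁻¹' B' n,
          C.indicator (fun p => p B₀) (M.pstar ω) ∂μ :=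
        (M.setLIntegral_pstar _ hB'm ((Measure.measurable_coe hB₀).indicator hC)).symm
    _ = _ := by
        rw [← Measure.restrict_restrict (hp hC), ← lintegral_indicator (hp hC)]
        rfl

lemma hasLawGiven_seeds_pastOutcomes_pstar [IsFiniteMeasure μ] (n : ℕ) :
    HasLawGiven (M.outcome t) M.pstarKernel
      (fun ω => (M.seeds n ω, M.pastOutcomes t ω, M.pstar ω)) μ := by
  induction n with
  | zero =>
    have hseeds : M.seeds 0 = fun _ => Fin.elim0 := Subsingleton.elim _ _
    rw [hseeds]
    exact (M.hasLawGiven_pastOutcomes_pstar t).comp measurable_prodMk_left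
  | succ n ih =>
    have hproj : Measurable fun q : ({s : ℕ // s ≠ n} → 𝒰) × (ℕ → A → 𝒴) × Measure (A → 𝒴) =>
        (((fun s : Fin n => q.1 ⟨s, s.2.ne⟩), (fun s : Fin t => q.2.1 s), q.2.2), q.2.1 t, q.2.2) :=
      by fun_prop
    have hV := (M.measurable_seeds n).prodMk
      ((M.measurable_pastOutcomes t).prodMk M.measurable_pstar)
    have hadd := ih.prodMk_of_indepFun (M.measurable_outcome t) hV (M.measurable_U n)
      ((M.indep_U n).comp measurable_id hproj)
    let snoc := (MeasurableEquiv.piFinSuccAbove (fun _ => 𝒰) (Fin.last n)).symm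
    have hseeds : M.seeds (n + 1) = fun ω => snoc (M.U n ω, M.seeds n ω) := by
      funext ω s
      refine Fin.lastCases ?_ (fun i => ?_) s <;> simp [snoc, seeds]
    rw [hseeds]
    exact hadd.comp (f := fun q => (snoc (q.1, q.2.1), q.2.2)) (by fun_prop)

lemma hasLawGiven_hist_pstar [IsFiniteMeasure μ] [Countable A] [DiscreteMeasurableSpace A]
    [Nonempty A] [StandardBorelSpace 𝒴] [Nonempty 𝒴] :
    HasLawGiven (M.outcome t) M.pstarKernel (fun ω => (M.hist t ω, M.pstar ω)) μ := by
  obtain ⟨F, hF, hhist⟩ := M.exists_hist_eq_comp t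
  rw [hhist]
  exact (M.hasLawGiven_seeds_pastOutcomes_pstar t t).comp
    (f := fun q => (F (q.1, q.2.1), q.2.2)) (by fun_prop)

end OutcomeLaw

end BanditModel

section ConditionalMeanMem

variable {Ω E F H : Type*} [MeasurableSpace Ω] [MeasurableSpace E] [MeasurableSpace F]
  [NormedAddCommGroup H] [NormedSpace ℝ H]

lemma integrable_inv_lintegral_smul_compProd {ν : Measure F} [IsFiniteMeasure ν] {κ : Kernel F E}
    [IsSFiniteKernel κ] {φ : E → H} (hφ : StronglyMeasurable φ) :
    Integrable (fun q : F × E => (1 + ∫⁻ y, ‖φ y‖ₑ ∂(κ q.1))⁻¹.toReal • φ q.2) (ν ⊗ₘ κ) := by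
  have hN : Measurable fun x => (1 + ∫⁻ y, ‖φ y‖ₑ ∂(κ x))⁻¹ :=
    (measurable_const.add hφ.enorm.lintegral_kernel).inv
  have hφ' : StronglyMeasurable fun q : F × E => (1 + ∫⁻ y, ‖φ y‖ₑ ∂(κ q.1))⁻¹.toReal • φ q.2 :=
    ((hN.comp measurable_fst).ennreal_toReal.stronglyMeasurable).smul
      (hφ.comp_measurable measurable_snd)
  refine ⟨hφ'.aestronglyMeasurable, ?_⟩
  rw [HasFiniteIntegral, Measure.lintegral_compProd hφ'.enorm]
  calc ∫⁻ x, ∫⁻ y, ‖(1 + ∫⁻ y, ‖φ y‖ₑ ∂(κ x))⁻¹.toReal • φ y‖ₑ ∂(κ x) ∂ν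
      ≤ ∫⁻ _, 1 ∂ν := by
        refine lintegral_mono fun x => ?_
        have hinv : (1 + ∫⁻ y, ‖φ y‖ₑ ∂(κ x))⁻¹ ≠ ∞ := by simp
        simp_rw [enorm_smul, Real.enorm_of_nonneg ENNReal.toReal_nonneg, ENNReal.ofReal_toReal hinv]
        rw [lintegral_const_mul _ hφ.enorm, mul_comm, ← div_eq_mul_inv]
        exact ENNReal.div_le_of_le_mul (by simp)
    _ < ∞ := by simp

variable [CompleteSpace H] {V : Submodule ℝ H}

lemma integral_mem_of_forall_mem {μ : Measure Ω} (hV : IsClosed (V : Set H)) {f : Ω → H}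
    (hf : ∀ ω, f ω ∈ V) : ∫ ω, f ω ∂μ ∈ V := by
  by_cases hint : Integrable f μ
  · have := hV
    have hcomm : ∫ ω, V.mkQL (f ω) ∂μ = V.mkQL (∫ ω, f ω ∂μ) := V.mkQL.integral_comp_comm hint
    have hzero : ∀ ω, V.mkQL (f ω) = 0 := fun ω => (Submodule.Quotient.mk_eq_zero V).mpr (hf ω)
    simp_rw [hzero, integral_zero] at hcomm
    exact (Submodule.Quotient.mk_eq_zero V).mp hcomm.symm
  · rw [integral_undef hint]
    exact V.zero_mem

lemma ae_mem_of_forall_setIntegral_mem {μ : Measure Ω} [SigmaFinite μ] (hV : IsClosed (V : Set H))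
    {f : Ω → H} (hf : Integrable f μ) (h : ∀ S, MeasurableSet S → ∫ ω in S, f ω ∂μ ∈ V) :
    ∀ᵐ ω ∂μ, f ω ∈ V := by
  have := hV
  let q : H →L[ℝ] H ⧸ V := V.mkQL
  have hzero : (fun ω => q (f ω)) =ᵐ[μ] 0 := by
    refine ae_eq_zero_of_forall_setIntegral_eq_of_sigmaFinite
      (fun S _ _ => (q.integrable_comp hf).integrableOn) fun S hS _ => ?_
    rw [q.integral_comp_comm hf.integrableOn]
    exact (Submodule.Quotient.mk_eq_zero V).mpr (h S hS)
  filter_upwards [hzero] with ω hω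
  exact (Submodule.Quotient.mk_eq_zero V).mp hω

variable [StandardBorelSpace E] [Nonempty E] {μ : Measure Ω} [IsFiniteMeasure μ] {X : Ω → F}
  {Y : Ω → E}

lemma ae_integral_condDistrib_mem (hX : Measurable X) (hY : Measurable Y)
    (hV : IsClosed (V : Set H)) {φ : E → H} (hφ : StronglyMeasurable φ)
    (h : ∀ w : F → ℝ, Measurable w → Integrable (fun ω => w (X ω) • φ (Y ω)) μ →
      ∫ ω, w (X ω) • φ (Y ω) ∂μ ∈ V) :
    ∀ᵐ ω ∂μ, ∫ y, φ y ∂(condDistrib Y X μ (X ω)) ∈ V := by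
  set κ := condDistrib Y X μ
  let w : F → ℝ := fun x => (1 + ∫⁻ y, ‖φ y‖ₑ ∂(κ x))⁻¹.toReal
  have hw : Measurable w :=
    (measurable_const.add hφ.enorm.lintegral_kernel).inv.ennreal_toReal
  have hint : Integrable (fun q : F × E => w q.1 • φ q.2) (μ.map X ⊗ₘ κ) :=
    integrable_inv_lintegral_smul_compProd hφ
  have hsetInt : ∀ S, MeasurableSet S → ∫ x in S, ∫ y, w x • φ y ∂(κ x) ∂(μ.map X) ∈ V := by
    intro S hS
    have hwS : Measurable (S.indicator w) := hw.indicator hS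
    have hmeas : StronglyMeasurable fun q : F × E => S.indicator w q.1 • φ q.2 :=
      (hwS.comp measurable_fst).stronglyMeasurable.smul (hφ.comp_measurable measurable_snd)
    have hind : (fun q : F × E => S.indicator w q.1 • φ q.2) =
        (S ×ˢ univ).indicator fun q => w q.1 • φ q.2 := by
      funext q
      by_cases hq : q.1 ∈ S <;> simp [hq]
    have hintS : Integrable (fun q : F × E => S.indicator w q.1 • φ q.2) (μ.map X ⊗ₘ κ) := by
      rw [hind]
      exact hint.indicator (hS.prod .univ)
    have hlaw : μ.map X ⊗ₘ κ = μ.map fun ω => (X ω, Y ω) := compProd_map_condDistrib hY.aemeasurable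
    have hXY : AEMeasurable (fun ω => (X ω, Y ω)) μ := (hX.prodMk hY).aemeasurable
    have hmem := h (S.indicator w) hwS
      ((integrable_map_measure hmeas.aestronglyMeasurable hXY).mp (hlaw ▸ hintS))
    rw [← integral_map (f := fun q : F × E => S.indicator w q.1 • φ q.2) hXY
      hmeas.aestronglyMeasurable, ← hlaw, hind, integral_indicator (hS.prod .univ),
      Measure.setIntegral_compProd hS .univ hint.integrableOn] at hmem
    simpa only [Measure.restrict_univ] using hmem
  filter_upwards [ae_of_ae_map hX.aemeasurable
    (ae_mem_of_forall_setIntegral_mem hV hint.integral_compProd hsetInt)] with ω hω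
  by_cases hφint : Integrable φ (κ (X ω))
  · rw [integral_smul] at hω
    refine (V.smul_mem_iff ?_).mp hω
    exact ENNReal.toReal_ne_zero.mpr ⟨by simp [hφint.2.ne], by simp⟩
  · rw [integral_undef hφint]
    exact V.zero_mem

end ConditionalMeanMem

section LinearRewards

variable {ι : Type*} {d : ℕ}

/-- The space of the reward vectors `(⟨φ a, θ⟩)_a` that are linear in the features `φ`. -/
def linearRewards (φ : ι → Fin d → ℝ) : Submodule ℝ (EuclideanSpace ℝ ι) :=
  Submodule.span ℝ (range fun i => WithLp.toLp 2 fun a => φ a i)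

lemma finrank_linearRewards_le (φ : ι → Fin d → ℝ) : Module.finrank ℝ (linearRewards φ) ≤ d :=
  (finrank_range_le_card _).trans_eq (Fintype.card_fin d)

lemma toLp_mem_linearRewards (φ : ι → Fin d → ℝ) (θ : Fin d → ℝ) :
    WithLp.toLp 2 (fun a => ∑ i, φ a i * θ i) ∈ linearRewards φ := by
  have hsum : WithLp.toLp 2 (fun a => ∑ i, φ a i * θ i) =
      ∑ i, θ i • (WithLp.toLp 2 fun a => φ a i : EuclideanSpace ℝ ι) := by
    ext a
    simp [mul_comm]
  rw [hsum]
  exact sum_mem fun i _ => Submodule.smul_mem _ _ (Submodule.subset_span (mem_range_self i))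

end LinearRewards

namespace BanditModel

section Linear

variable {Ω : Type*} [MeasurableSpace Ω] {μ : Measure Ω} {A 𝒴 𝒰 : Type*}
  [MeasurableSpace A] [MeasurableSpace 𝒴] [MeasurableSpace 𝒰] (M : BanditModel μ A 𝒴 𝒰)

/-- The vector of the rewards of all actions, as a function of the outcome vector. -/
def rewardVec (y : A → 𝒴) : EuclideanSpace ℝ A := WithLp.toLp 2 fun a => M.R (y a)

lemma stronglyMeasurable_rewardVec [Countable A] : StronglyMeasurable M.rewardVec := by
  have hR := M.measurable_R
  refine Measurable.stronglyMeasurable ?_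
  exact (WithLp.measurable_toLp 2 _).comp (by fun_prop)

variable [Fintype A]

lemma integrable_rewardVec_iff {S : Type*} [MeasurableSpace S] {P : Measure S} {y : S → A → 𝒴} :
    Integrable (fun w => M.rewardVec (y w)) P ↔ ∀ a, Integrable (fun w => M.R (y w a)) P :=
  integrable_piLp_iff

lemma integral_rewardVec_apply {S : Type*} [MeasurableSpace S] {P : Measure S} {y : S → A → 𝒴}
    (hint : ∀ a, Integrable (fun w => M.R (y w a)) P) (a : A) :
    (∫ w, M.rewardVec (y w) ∂P) a = ∫ w, M.R (y w a) ∂P :=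
  eval_integral_piLp hint a

lemma toLp_setIntegral_sub_integral_mem [MeasurableSingletonClass A]
    {P : Measure (A × A × (A → 𝒴))} [IsFiniteMeasure P]
    (hint : ∀ a, Integrable (fun w => M.R (w.2.2 a)) P) {V : Submodule ℝ (EuclideanSpace ℝ A)}
    (hmem : ∀ b, ∫ w in Prod.fst ⁻¹' {b}, M.rewardVec w.2.2 ∂P ∈ V) (b : A) :
    WithLp.toLp 2 (fun a => ∫ w in Prod.fst ⁻¹' {b},
      (M.R (w.2.2 a) - ∫ z, M.R (z.2.2 a) ∂P) ∂P) ∈ V := by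
  have hmean : ∫ w, M.rewardVec w.2.2 ∂P = ∑ c, ∫ w in Prod.fst ⁻¹' {c}, M.rewardVec w.2.2 ∂P :=
    integral_eq_sum_setIntegral measurable_fst (M.integrable_rewardVec_iff.mpr hint)
  have hsplit : WithLp.toLp 2 (fun a => ∫ w in Prod.fst ⁻¹' {b},
      (M.R (w.2.2 a) - ∫ z, M.R (z.2.2 a) ∂P) ∂P) =
      ∫ w in Prod.fst ⁻¹' {b}, M.rewardVec w.2.2 ∂P -
        P.real (Prod.fst ⁻¹' {b}) • ∫ w, M.rewardVec w.2.2 ∂P := by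
    ext a
    rw [PiLp.sub_apply, PiLp.smul_apply, M.integral_rewardVec_apply hint,
      M.integral_rewardVec_apply fun a => (hint a).integrableOn,
      ← setIntegral_const, ← integral_sub (hint a).integrableOn (integrable_const _)]
  rw [hsplit, hmean]
  exact V.sub_mem (hmem b) (V.smul_mem _ (V.sum_mem fun c _ => hmem c))

variable {d : ℕ} {φ : A → Fin d → ℝ}

lemma IsLinear.integral_rewardVec_mem {M : BanditModel μ A 𝒴 𝒰} (hφ : M.IsLinear φ)
    {p : Measure (A → 𝒴)} (hp : p ∈ M.family) :
    ∫ y, M.rewardVec y ∂p ∈ linearRewards φ := by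
  by_cases hint : Integrable M.rewardVec p
  · obtain ⟨θ, hθ⟩ := hφ p hp
    convert toLp_mem_linearRewards φ θ using 1
    ext a
    exact (M.integral_rewardVec_apply (M.integrable_rewardVec_iff.mp hint) a).trans (hθ a)
  · rw [integral_undef hint]
    exact zero_mem _

variable [IsFiniteMeasure μ] [DiscreteMeasurableSpace A] [Nonempty A] [StandardBorelSpace 𝒴]
  [Nonempty 𝒴]

lemma IsLinear.integral_smul_rewardVec_mem {M : BanditModel μ A 𝒴 𝒰} (hφ : M.IsLinear φ) (t : ℕ)
    {u : (Fin t → A × 𝒴) × Measure (A → 𝒴) → ℝ} (hu : Measurable u)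
    (hint : Integrable (fun ω => u (M.hist t ω, M.pstar ω) • M.rewardVec (M.outcome t ω)) μ) :
    ∫ ω, u (M.hist t ω, M.pstar ω) • M.rewardVec (M.outcome t ω) ∂μ ∈ linearRewards φ := by
  have hlaw := M.hasLawGiven_hist_pstar t
  have hmeas : StronglyMeasurable fun q : ((Fin t → A × 𝒴) × Measure (A → 𝒴)) × (A → 𝒴) =>
      u q.1 • M.rewardVec q.2 :=
    (hu.comp measurable_fst).stronglyMeasurable.smul
      (M.stronglyMeasurable_rewardVec.comp_measurable measurable_snd)
  rw [hlaw.integral_eq (M.measurable_outcome t) ((M.measurable_hist t).prodMk M.measurable_pstar)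
    hmeas hint]
  simp_rw [integral_smul]
  exact integral_mem_of_forall_mem (Submodule.closed_of_finiteDimensional _) fun ω =>
    Submodule.smul_mem _ _ (hφ.integral_rewardVec_mem (M.pstar_mem ω))

lemma IsLinear.ae_integral_posterior_mem {M : BanditModel μ A 𝒴 𝒰} (hφ : M.IsLinear φ) (t : ℕ)
    (b : A) :
    ∀ᵐ ω ∂μ, ∫ w in Prod.fst ⁻¹' {b}, M.rewardVec w.2.2 ∂(M.posterior t ω) ∈ linearRewards φ := by
  obtain ⟨α, hα, hopt⟩ := M.exists_optimalAction_eq_comp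
  have hb : MeasurableSet (Prod.fst ⁻¹' {b} : Set (A × A × (A → 𝒴))) :=
    measurable_fst (measurableSet_singleton b)
  simp_rw [← integral_indicator hb]
  refine ae_integral_condDistrib_mem (M.measurable_hist t)
    (M.measurable_triple t (M.measurable_outcome t)) (Submodule.closed_of_finiteDimensional _)
    ((M.stronglyMeasurable_rewardVec.comp_measurable (by fun_prop)).indicator hb)
    fun w hw hint => ?_
  have hweight : ∀ ω, w (M.hist t ω) • (Prod.fst ⁻¹' {b} : Set (A × A × (A → 𝒴))).indicator
      (fun w => M.rewardVec w.2.2) (M.triple t (M.outcome t) ω) =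
      (w (M.hist t ω) * (α ⁻¹' {b}).indicator 1 (M.pstar ω)) • M.rewardVec (M.outcome t ω) := by
    intro ω
    have hiff : M.Astar ω = α (M.pstar ω) := congrFun hopt ω
    by_cases hω : α (M.pstar ω) = b <;> simp [triple, hiff, hω]
  simp_rw [hweight] at hint ⊢
  exact hφ.integral_smul_rewardVec_mem t
    (u := fun q => w q.1 * (α ⁻¹' {b}).indicator 1 q.2)
    ((hw.comp measurable_fst).mul ((measurable_one.indicator
      (hα (measurableSet_singleton b))).comp measurable_snd)) hint

end Linear

variable {Ω : Type*} [MeasurableSpace Ω] {μ : Measure Ω} [IsProbabilityMeasure μ] {A 𝒴 𝒰 : Type*}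
  [Fintype A] [Nonempty A] [MeasurableSpace A] [DiscreteMeasurableSpace A] [MeasurableSpace 𝒴]
  [StandardBorelSpace 𝒴] [Nonempty 𝒴] [MeasurableSpace 𝒰] (M : BanditModel μ A 𝒴 𝒰) (t : ℕ)

theorem ae_infoRatioLE_of_isLinear (hTS : M.IsThompsonSampling) {σ : ℝ}
    (hsub : ∀ a, M.CenteredSubGaussian t (M.reward t a) fun _ => σ) {d : ℕ} {φ : A → Fin d → ℝ}
    (hφ : M.IsLinear φ) :
    ∀ᵐ ω ∂μ, M.InfoRatioLE t (2 * d * σ ^ 2) ω := by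
  refine M.ae_infoRatioLE_of_sq_sum_setIntegral_le hTS hsub ?_
  filter_upwards [ae_all_iff.mpr (hφ.ae_integral_posterior_mem t)] with ω hmem P hω hmatch
  have hint : ∀ a, Integrable (fun w => M.R (w.2.2 a)) P := fun a =>
    integrable_of_hasSubgaussianMGF_sub_const (hω a)
  have hsq := hmatch.sq_sum_setIntegral_le_of_mem_submodule
    (fun a => (M.measurable_R.comp (comap_measurable _)).sub_const _) hω
    (finrank_linearRewards_le φ) (M.toLp_setIntegral_sub_integral_mem hint hmem)
  rwa [Real.coe_toNNReal _ (sq_nonneg σ)] at hsq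

end BanditModel

section Gap

variable {Ω E : Type*} [MeasurableSpace Ω] [MeasurableSpace E] {P Q : Measure Ω}

lemma cond_le_smul (P : Measure Ω) (s : Set Ω) : P[|s] ≤ (P s)⁻¹ • P := fun u => by
  simpa only [ProbabilityTheory.cond, Measure.smul_apply, smul_eq_mul]
    using mul_le_mul_right (Measure.restrict_apply_le s u) _

lemma klDiv_map_cond_ne_top [IsProbabilityMeasure P] {s : Set Ω} (hs : P s ≠ 0) {Y : Ω → E}
    (hY : Measurable Y) : klDiv (P[|s].map Y) (P.map Y) ≠ ∞ := by
  refine klDiv_ne_top_of_le_smul (ENNReal.inv_ne_top.mpr hs) ?_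
  rw [← Measure.map_smul]
  exact Measure.map_mono (cond_le_smul P s) hY

lemma sq_integral_sub_integral_le_toReal_klDiv_map [IsProbabilityMeasure Q]
    [IsProbabilityMeasure P] {Y : Ω → E} (hY : Measurable Y) {f : E → ℝ} (hf : Measurable f)
    (hD : klDiv (Q.map Y) (P.map Y) ≠ ∞) (hQ : Integrable (fun x => f (Y x)) Q) {c : ℝ≥0}
    (h : HasSubgaussianMGF (fun x => f (Y x) - ∫ z, f (Y z) ∂P) c P) :
    (∫ x, f (Y x) ∂Q - ∫ x, f (Y x) ∂P) ^ 2 ≤ 2 * c * (klDiv (Q.map Y) (P.map Y)).toReal := by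
  have := Measure.isProbabilityMeasure_map (μ := P) hY.aemeasurable
  have := Measure.isProbabilityMeasure_map (μ := Q) hY.aemeasurable
  have hfc : Measurable fun y => f y - ∫ z, f (Y z) ∂P := hf.sub_const _
  have hgap : ∫ y, (f y - ∫ z, f (Y z) ∂P) ∂(Q.map Y) = ∫ x, f (Y x) ∂Q - ∫ x, f (Y x) ∂P := by
    rw [integral_map hY.aemeasurable hfc.aestronglyMeasurable,
      integral_sub hQ (integrable_const _), integral_const, probReal_univ, one_smul]
  rw [← hgap]
  refine sq_integral_le_toReal_klDiv hD ?_ ?_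
  · exact (integrable_map_measure hfc.aestronglyMeasurable hY.aemeasurable).mpr
      (hQ.sub (integrable_const _))
  · rw [← HasSubgaussianMGF.id_map_iff hfc.aemeasurable, Measure.map_map hfc hY]
    exact (HasSubgaussianMGF.id_map_iff (hfc.comp hY).aemeasurable).mpr h

end Gap

namespace BanditModel

variable {Ω : Type*} [MeasurableSpace Ω] {μ : Measure Ω} [IsFiniteMeasure μ] {A 𝒴 𝒰 : Type*}
  [Fintype A] [Nonempty A] [MeasurableSpace A] [DiscreteMeasurableSpace A] [MeasurableSpace 𝒴]
  [StandardBorelSpace 𝒴] [Nonempty 𝒴] [MeasurableSpace 𝒰] (M : BanditModel μ A 𝒴 𝒰) (t : ℕ)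

lemma outcomeDiv_ne_top {ω : Ω} (a : A) {astar : A}
    (h : M.posterior t ω {w | w.1 = astar} ≠ 0) : M.outcomeDiv t a astar ω ≠ ∞ :=
  klDiv_map_cond_ne_top h (by fun_prop)

lemma integrable_posteriorGiven {ω : Ω} {astar : A}
    (h : M.posterior t ω {w | w.1 = astar} ≠ 0) {f : A × A × (A → 𝒴) → ℝ}
    (hf : Integrable f (M.posterior t ω)) : Integrable f (M.posteriorGiven t astar ω) :=
  hf.of_measure_le_smul (ENNReal.inv_ne_top.mpr h) (cond_le_smul _ _)

lemma integral_posteriorGiven_sub_integral_posterior_le {ω : Ω} {s : ℝ} (hs : 0 ≤ s)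
    {a astar : A} (h : M.posterior t ω {w | w.1 = astar} ≠ 0)
    (hsub : HasSubgaussianMGF (fun w => M.R (w.2.2 a) - ∫ z, M.R (z.2.2 a) ∂(M.posterior t ω))
      (s ^ 2).toNNReal (M.posterior t ω)) :
    ∫ w, M.R (w.2.2 a) ∂(M.posteriorGiven t astar ω) - ∫ w, M.R (w.2.2 a) ∂(M.posterior t ω) ≤
      s * √(2 * (M.outcomeDiv t a astar ω).toReal) := by
  have : IsProbabilityMeasure (M.posteriorGiven t astar ω) := cond_isProbabilityMeasure h
  have hsq := sq_integral_sub_integral_le_toReal_klDiv_map (by fun_prop) M.measurable_R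
    (M.outcomeDiv_ne_top t a h)
    (M.integrable_posteriorGiven t h (integrable_of_hasSubgaussianMGF_sub_const hsub)) hsub
  refine le_of_abs_le (abs_le_of_sq_le_sq (hsq.trans_eq ?_) (by positivity))
  rw [Real.coe_toNNReal _ (sq_nonneg s), mul_pow, Real.sq_sqrt (by positivity), outcomeDiv]
  ring

end BanditModel

theorem mainTheorem7 {Ω : Type*} [MeasurableSpace Ω] (μ : Measure Ω) [IsProbabilityMeasure μ]
    {A 𝒴 𝒰 : Type*} [Fintype A] [Nonempty A] [MeasurableSpace A] [DiscreteMeasurableSpace A]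
    [MeasurableSpace 𝒴] [StandardBorelSpace 𝒴] [Nonempty 𝒴] [MeasurableSpace 𝒰]
    (M : BanditModel μ A 𝒴 𝒰) (t : ℕ) :
    -- the gap between conditional and unconditional posterior mean rewards
    (∀ σ : Ω → ℝ, Measurable[M.histSigma t] σ → (∀ᵐ ω ∂μ, 0 ≤ σ ω) →
      (∀ a, M.CenteredSubGaussian t (M.reward t a) σ) →
      ∀ a astar : A, ∀ᵐ ω ∂μ, M.posterior t ω {w | w.1 = astar} ≠ 0 →
        Integrable (fun w => M.R (w.2.2 a)) (M.posterior t ω) ∧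
        Integrable (fun w => M.R (w.2.2 a)) (M.posteriorGiven t astar ω) ∧
        M.outcomeDiv t a astar ω ≠ ∞ ∧
        (∫ w, M.R (w.2.2 a) ∂(M.posteriorGiven t astar ω)) -
            (∫ w, M.R (w.2.2 a) ∂(M.posterior t ω)) ≤
          σ ω * √(2 * (M.outcomeDiv t a astar ω).toReal)) ∧
    -- bounds on the information ratio of Thompson sampling
    (M.IsThompsonSampling → ∀ σ : ℝ,
      ((∀ a, M.CenteredSubGaussian t (M.reward t a) (fun _ => σ)) →
        (∀ᵐ ω ∂μ, M.InfoRatioLE t (2 * (Fintype.card A : ℝ) * σ ^ 2) ω) ∧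
        (∀ (𝒵 : Type*) [MeasurableSpace 𝒵] (Z : Ω → 𝒵) (enc : A → 𝒵 → 𝒴),
          M.IsFullInformation t Z enc → ∀ᵐ ω ∂μ, M.InfoRatioLE t (2 * σ ^ 2) ω) ∧
        (∀ (d : ℕ) (φ : A → Fin d → ℝ),
          M.IsLinear φ → ∀ᵐ ω ∂μ, M.InfoRatioLE t (2 * (d : ℝ) * σ ^ 2) ω)) ∧
      (∀ (d m : ℕ) (S : A → Finset (Fin d)) (θ : Fin d → Ω → ℝ)
          (enc : (a : A) → (S a → ℝ) → 𝒴),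
        0 < m → M.IsSemiBandit t m S θ enc →
        (∀ i, M.CenteredSubGaussian t (θ i) (fun _ => σ)) →
        ∀ᵐ ω ∂μ, M.InfoRatioLE t (2 * (d : ℝ) * σ ^ 2 / (m : ℝ) ^ 2) ω)) := by
  refine ⟨fun σ _ hσ hsub a astar => ?_, fun hTS σ => ⟨fun hsub => ⟨?_, ?_, ?_⟩, ?_⟩⟩
  · filter_upwards [hσ, M.ae_hasSubgaussianMGF_posterior t hsub] with ω hσω hω hastar
    have hint := integrable_of_hasSubgaussianMGF_sub_const (hω a)
    exact ⟨hint, M.integrable_posteriorGiven t hastar hint, M.outcomeDiv_ne_top t a hastar,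
      M.integral_posteriorGiven_sub_integral_posterior_le t hσω hastar (hω a)⟩
  · exact M.ae_infoRatioLE_card t hTS hsub
  · exact fun _ _ _ _ hF => M.ae_infoRatioLE_of_isFullInformation t hTS hsub hF
  · exact fun _ _ hφ => M.ae_infoRatioLE_of_isLinear t hTS hsub hφ
  · exact fun _ _ _ _ _ _ hS hθ => M.ae_infoRatioLE_of_isSemiBandit t hTS hS hθ
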